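/- Let $f\in C^1(\mathbb R^2,\mathbb R^2)$ be a Hamiltonian vector field ($f=(\partial_2H,-\partial_1H)$ for some $C^2$ function $H$). Let $x_0$ be a $T$-periodic cycle of $\dot x=f(x)$, that is, a nonconstant solution with period $T>0$. Assume that $x_0$ is nondegenerate: the linearized system $\dot y=f'(x_0(t))y$ has a solution that is not $T$-periodic. Let $g:\mathbb R\times\mathbb R^2\times[0,1]\to K(\mathbb R^2)$ be upper semicontinuous, where $K(\mathbb R^2)$ denotes the nonempty compact convex subsets of $\mathbb R^2$, and assume (H) for every bounded $B\subset\mathbb R^2$ there is $\mu_B\in L^\infty_{loc}(\mathbb R)$ with $\|v\|\le\mu_B(t)$ for all $t\in\mathbb R$, $x\in B$, $\varepsilon\in[0,1]$, $v\in g(t,x,\varepsilon)$. For all small $\varepsilon>0$ let $x_\varepsilon:\mathbb R\to\mathbb R^2$ be a $T$-periodic (locally absolutely continuous) solution of $\dot x\in f(x)+\varepsilon g(t,x,\varepsilon)$ for a.a. $t\in\mathbb R$, and assume $x_\varepsilon\to x_0$ as $\varepsilon\to0$, uniformly on $[0,T]$. Let $\widetilde z$ be a nontrivial $T$-periodic solution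 of the adjoint system $\dot z=-(f'(x_0(t)))^*z$, let $\widehat z$ be a solution of it that is linearly independent of $\widetilde z$ and normalized by $\langle\dot x_0(0),\widehat z(0)\rangle=1$, and let $t_*\in[0,T]$ satisfy $\widetilde z_1(t_*)=0$. Put $$y(t)=\frac{1}{\det(\widehat z(t),\widetilde z(t))}\begin{pmatrix}-\widehat z_2(t)\\ \widehat z_1(t)\end{pmatrix},\qquad \gamma(t_*)=\frac{\widetilde z_2(t_*)}{\widehat z_2(T+t_*)-\widehat z_2(t_*)},$$ $$M^\bot(t)=\Big\{\gamma(t_*)\int_{t-T}^t\langle\widehat z(\tau),h(\tau)\rangle\,d\tau:\ h\in L^\infty([-T,T],\mathbb R^2),\ h(\tau)\in g(\tau,x_0(\tau),0)\ \text{for a.a. }\tau\in[-T,T]\Big\}.$$ Then $y$ is a solution of the linearized system that is not $T$-periodic, $M^\bot(t)\neq\emptyset$ for every $t\in[0,T]$, and there is a family $\{\Delta_\varepsilon\}_{\varepsilon>0}$ of real numbers with $\Delta_\varepsilon\to0$ as $\varepsilon\to0$ such that $$\lim_{\varepsilon\to0}\frac1\varepsilon\,\rho\Big(x_\varepsilon(t+\Delta_\varepsilon)-x_0(t),\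 \varepsilon M^\bot(t)y(t)+\big\langle\widehat z(t),x_\varepsilon(t+\Delta_\varepsilon)-x_0(t)\big\rangle\dot x_0(t)\Big)=0$$ uniformly in $t\in[0,T]$, where $\rho(v,S)=\inf_{s\in S}\|v-s\|$. -/

import Mathlib

open Set Filter Topology MeasureTheory
open scoped ENNReal

noncomputable section

namespace PlanarCycle

/-- The Euclidean plane. -/
abbrev Plane : Type := EuclideanSpace ℝ (Fin 2)

/-- `f` is a planar Hamiltonian vector field: `f = (∂H/∂ξ₂, -∂H/∂ξ₁)` for some `C²` function `H`. -/
def IsHamiltonianField (f : Plane → Plane) : Prop :=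
  ∃ H : Plane → ℝ, ContDiff ℝ 2 H ∧
    ∀ ξ, f ξ = !₂[fderiv ℝ H ξ (EuclideanSpace.single 1 1),
                  -fderiv ℝ H ξ (EuclideanSpace.single 0 1)]

/-- `x₀` is a `T`-periodic cycle of `ẋ = f x`: a nonconstant `T`-periodic solution, with `T > 0`. -/
structure IsCycle (f : Plane → Plane) (T : ℝ) (x₀ : ℝ → Plane) : Prop where
  period_pos : 0 < T
  isSolution : ∀ t, HasDerivAt x₀ (f (x₀ t)) t
  periodic : Function.Periodic x₀ T
  nonconstant : ∃ s t, x₀ s ≠ x₀ t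

/-- `y` solves the linearized system `ẏ = f'(x₀(t)) y` on the whole line. -/
def IsLinearizedSolution (f : Plane → Plane) (x₀ y : ℝ → Plane) : Prop :=
  ∀ t, HasDerivAt y (fderiv ℝ f (x₀ t) (y t)) t

/-- `z` solves the adjoint system `ż = -(f'(x₀(t)))^* z` on the whole line. -/
def IsAdjointSolution (f : Plane → Plane) (x₀ z : ℝ → Plane) : Prop :=
  ∀ t, HasDerivAt z (-(ContinuousLinearMap.adjoint (fderiv ℝ f (x₀ t)) (z t))) t

/-- The cycle is nondegenerate: the linearized system has a solution that is not `T`-periodic. -/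
def IsNondegenerate (f : Plane → Plane) (T : ℝ) (x₀ : ℝ → Plane) : Prop :=
  ∃ y : ℝ → Plane, IsLinearizedSolution f x₀ y ∧ ¬ Function.Periodic y T

/-- The values `g(t, ξ, ε)`, `ε ∈ [0,1]`, are nonempty compact convex subsets of the plane. -/
def HasCompactConvexValues (g : ℝ → Plane → ℝ → Set Plane) : Prop :=
  ∀ t ξ, ∀ ε ∈ Icc (0 : ℝ) 1,
    (g t ξ ε).Nonempty ∧ IsCompact (g t ξ ε) ∧ Convex ℝ (g t ξ ε)

/-- Joint upper semicontinuity of the multivalued map `g` on `ℝ × ℝ² × [0,1]`. -/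
def IsUSC (g : ℝ → Plane → ℝ → Set Plane) : Prop :=
  UpperHemicontinuousOn (fun p : ℝ × Plane × ℝ => g p.1 p.2.1 p.2.2)
    (univ ×ˢ univ ×ˢ Icc (0 : ℝ) 1)

/-- Condition (H): on each bounded set `B` of states, `g` is bounded by a function `μ_B(t)` in
`L^∞_loc(ℝ)`. -/
def ConditionH (g : ℝ → Plane → ℝ → Set Plane) : Prop :=
  ∀ B : Set Plane, Bornology.IsBounded B →
    ∃ μ : ℝ → ℝ, (∀ a b, MemLp μ ∞ (volume.restrict (Icc a b))) ∧
      ∀ t, ∀ ξ ∈ B, ∀ ε ∈ Icc (0 : ℝ) 1, ∀ v ∈ g t ξ ε, ‖v‖ ≤ μ t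

/-- `x` is a `T`-periodic solution of `ẋ ∈ f x + ε g(t, x, ε)`: it is `T`-periodic, absolutely
continuous on every compact interval, and satisfies the inclusion for almost every `t`. -/
structure IsPeriodicInclusionSolution (f : Plane → Plane) (g : ℝ → Plane → ℝ → Set Plane)
    (T ε : ℝ) (x : ℝ → Plane) : Prop where
  periodic : Function.Periodic x T
  absolutelyContinuous : ∀ a b, AbsolutelyContinuousOnInterval x a b
  inclusion : ∀ᵐ t, ∃ v ∈ g t (x t) ε, HasDerivAt x (f (x t) + ε • v) t

/-- The determinant of the matrix with columns `u`, `v`. -/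
def det₂ (u v : Plane) : ℝ := u 0 * v 1 - v 0 * u 1

/-- The function `y = (-ẑ₂, ẑ₁) / det(ẑ, z̃)`; it is the second column of the inverse of the matrix
with rows `ẑ`, `z̃` (here `zh = ẑ`, `zt = z̃`). -/
def yFun (zh zt : ℝ → Plane) (t : ℝ) : Plane :=
  !₂[-(zh t 1) / det₂ (zh t) (zt t), zh t 0 / det₂ (zh t) (zt t)]

/-- The constant `γ(t_*) = z̃₂(t_*) / (ẑ₂(T + t_*) - ẑ₂(t_*))`. -/
def gam (T : ℝ) (zh zt : ℝ → Plane) (ts : ℝ) : ℝ :=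
  zt ts 1 / (zh (T + ts) 1 - zh ts 1)

/-- The multivalued map `M^⊥(t)`: the values `γ(t_*) ∫_{t-T}^t ⟨ẑ(τ), h(τ)⟩ dτ`, for `h` running
through the `L^∞` selections of `τ ↦ g(τ, x₀(τ), 0)` on `[-T, T]`. -/
def Mperp (g : ℝ → Plane → ℝ → Set Plane) (T : ℝ) (x₀ zh zt : ℝ → Plane) (ts t : ℝ) : Set ℝ :=
  {m | ∃ h : ℝ → Plane, MemLp h ∞ (volume.restrict (Icc (-T) T)) ∧
    (∀ᵐ τ ∂(volume.restrict (Icc (-T) T)), h τ ∈ g τ (x₀ τ) 0) ∧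
    m = gam T zh zt ts * ∫ τ in (t - T)..t, inner ℝ (zh τ) (h τ)}

end PlanarCycle

end

/-! Since `f` is Hamiltonian, `f'` has zero trace. Hence adjoint solutions have constant mutual
determinant, and a quarter turn carries solutions of the linearized system to adjoint solutions. The
rotated velocity of the cycle is a periodic adjoint solution, and nondegeneracy forbids two
independent ones, so `zt` is a multiple of it and is orthogonal to `ẋ₀`. Also `⟨zh, ẋ₀⟩ = 1` for all
time, so `zh(t+T) - zh(t)` is orthogonal to `ẋ₀(t)` and equals `κ zt(t)` with a constant `κ ≠ 0`
(`exists_floquetData`); at `ts` this reads `γ = 1/κ` (`FloquetData.gam_eq`). The pair `ẋ₀, y` is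
dual to `zh, zt` (`FloquetData.decomp`), so only `⟨zt, w⟩` has to be found to order `o(ε)`, where
`w(t) = x_ε(t+Δ_ε) - x₀(t)`.

The shift is chosen by the intermediate value theorem so that `⟨zh(0), w(0)⟩ = 0` (`exists_shift`).
Then `w` is periodic and `ẇ = f'(x₀)w + r + εh` with `‖r‖ ≤ η‖w‖`. Integrating `⟨zh, w⟩'` over a
period gives `κ⟨zt(t), w(t)⟩ = ∫ ⟨zh, r + εh⟩`; integrating from `0` bounds `⟨zh, w⟩`. Together
these give `w = O(ε)`, and the contribution of `r` is `O(ηε)` (`FloquetData.exists_estimate`).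

Finally `h` is projected onto the sets `g(τ, x₀(τ), 0)`. The projection is a measurable selection,
and its mean distance to `h` tends to `0` by upper semicontinuity and dominated convergence
(`tendsto_integral_infDist`), so `h` may be replaced by an admissible selection uniformly in `t`. -/

namespace PlanarCycle

/-! ### Trace-free matrices, determinant and rotation in the plane -/

section LinearAlgebra

lemma plane_decomp (v : Plane) :
    v = v 0 • EuclideanSpace.single (0 : Fin 2) (1 : ℝ)
      + v 1 • EuclideanSpace.single (1 : Fin 2) (1 : ℝ) := by
  ext i; fin_cases i <;> simp

lemma inner_plane (u v : Plane) : inner ℝ u v = u 0 * v 0 + u 1 * v 1 := by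
  simp [PiLp.inner_apply, Fin.sum_univ_two, mul_comm]

lemma map_apply_plane (L : Plane →L[ℝ] Plane) (v : Plane) (i : Fin 2) :
    L v i = v 0 * L (EuclideanSpace.single 0 1) i + v 1 * L (EuclideanSpace.single 1 1) i := by
  conv_lhs => rw [plane_decomp v]
  simp only [map_add, map_smul, PiLp.add_apply, PiLp.smul_apply, smul_eq_mul]

lemma adjoint_apply_plane (L : Plane →L[ℝ] Plane) (z : Plane) (i : Fin 2) :
    ContinuousLinearMap.adjoint L z i
      = L (EuclideanSpace.single i 1) 0 * z 0 + L (EuclideanSpace.single i 1) 1 * z 1 := by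
  have h := ContinuousLinearMap.adjoint_inner_right L (EuclideanSpace.single i 1) z
  rw [inner_plane (L _)] at h
  rw [← h, EuclideanSpace.inner_single_left]
  simp

/-- The rotation by a right angle. -/
def rot (v : Plane) : Plane := !₂[-(v 1), v 0]

@[simp] lemma rot_zero (v : Plane) : rot v 0 = -(v 1) := rfl
@[simp] lemma rot_one (v : Plane) : rot v 1 = v 0 := rfl

/-- The trace of a linear endomorphism of the plane vanishes. -/
def TraceZero (L : Plane →L[ℝ] Plane) : Prop :=
  L (EuclideanSpace.single 0 1) 0 + L (EuclideanSpace.single 1 1) 1 = 0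

lemma TraceZero.det_adjoint {L : Plane →L[ℝ] Plane} (hL : TraceZero L) (u v : Plane) :
    det₂ (ContinuousLinearMap.adjoint L u) v + det₂ u (ContinuousLinearMap.adjoint L v) = 0 := by
  unfold TraceZero at hL
  simp only [det₂, adjoint_apply_plane]
  linear_combination (u 0 * v 1 - u 1 * v 0) * hL

lemma TraceZero.rot_adjoint {L : Plane →L[ℝ] Plane} (hL : TraceZero L) (v : Plane) :
    rot (ContinuousLinearMap.adjoint L v) = -L (rot v) := by
  unfold TraceZero at hL
  ext i
  fin_cases i
  · simp [map_apply_plane L (rot v), adjoint_apply_plane]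
    linear_combination -v 1 * hL
  · simp [map_apply_plane L (rot v), adjoint_apply_plane]
    linear_combination v 0 * hL

lemma TraceZero.adjoint_rot {L : Plane →L[ℝ] Plane} (hL : TraceZero L) (v : Plane) :
    ContinuousLinearMap.adjoint L (rot v) = -rot (L v) := by
  unfold TraceZero at hL
  ext i
  fin_cases i
  · simp [map_apply_plane L v, adjoint_apply_plane]
    linear_combination -v 1 * hL
  · simp [map_apply_plane L v, adjoint_apply_plane]
    linear_combination v 0 * hL

lemma eq_zero_of_inner_eq_zero {p q v : Plane} (h : det₂ p q ≠ 0)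
    (hp : inner ℝ p v = 0) (hq : inner ℝ q v = 0) : v = 0 := by
  rw [inner_plane] at hp hq
  unfold det₂ at h
  ext i
  apply mul_left_cancel₀ h
  fin_cases i
  · simp only [Fin.zero_eta, PiLp.zero_apply]
    linear_combination q 1 * hp - p 1 * hq
  · simp only [Fin.mk_one, PiLp.zero_apply]
    linear_combination p 0 * hq - q 0 * hp

lemma hasDerivAt_plane {u : ℝ → Plane} {u' : Plane} {t : ℝ} :
    HasDerivAt u u' t ↔ HasDerivAt (fun s => u s 0) (u' 0) t ∧ HasDerivAt (fun s => u s 1) (u' 1) t := by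
  rw [← Fin.forall_fin_two (p := fun i => HasDerivAt (fun s => u s i) (u' i) t), ← hasDerivAt_pi]
  refine ⟨fun h => (PiLp.hasFDerivAt_ofLp (𝕜 := ℝ) 2 (u t)).comp_hasDerivAt t h,
    fun h => ?_⟩
  have h' : HasDerivAt (fun s => (u s).ofLp) u'.ofLp t := h
  have ht : HasFDerivAt (WithLp.toLp 2 : (Fin 2 → ℝ) → Plane) _ ((fun s => (u s).ofLp) t) :=
    PiLp.hasFDerivAt_toLp (𝕜 := ℝ) 2 (u t).ofLp
  exact ht.comp_hasDerivAt t h'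

lemma HasDerivAt.rot {u : ℝ → Plane} {u' : Plane} {t : ℝ} (h : HasDerivAt u u' t) :
    HasDerivAt (fun s => PlanarCycle.rot (u s)) (PlanarCycle.rot u') t := by
  rw [hasDerivAt_plane] at h ⊢
  exact ⟨h.2.neg, h.1⟩

end LinearAlgebra

lemma eq_of_hasDerivAt_zero {φ : ℝ → ℝ} (h : ∀ t, HasDerivAt φ 0 t) (s t : ℝ) : φ s = φ t :=
  is_const_of_deriv_eq_zero (fun t => (h t).differentiableAt) (fun t => (h t).deriv) s t

/-! ### Divergence of a Hamiltonian field -/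

section Hamiltonian

variable {f : Plane → Plane}

/-- The trace is `∂₁∂₂H - ∂₂∂₁H`, zero by symmetry of the second derivative. -/
lemma IsHamiltonianField.traceZero (h : IsHamiltonianField f) (ξ : Plane) :
    TraceZero (fderiv ℝ f ξ) := by
  obtain ⟨H, hH, hf⟩ := h
  have hd : ContDiff ℝ 1 (fderiv ℝ H) := hH.fderiv_right (by norm_num)
  have hdd : HasFDerivAt (fderiv ℝ H) (fderiv ℝ (fderiv ℝ H) ξ) ξ :=
    (hd.differentiable (by norm_num) ξ).hasFDerivAt
  have hs : IsSymmSndFDerivAt ℝ H ξ :=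
    hH.contDiffAt.isSymmSndFDerivAt (by simp)
  have happ : ∀ e : Plane, HasFDerivAt (fun ζ => fderiv ℝ H ζ e)
      ((fderiv ℝ (fderiv ℝ H) ξ).flip e) ξ := fun e => by
    simpa using! hdd.clm_apply (hasFDerivAt_const e ξ)
  have hfd : HasFDerivAt f (fderiv ℝ f ξ) ξ := by
    apply DifferentiableAt.hasFDerivAt
    have : f = fun ζ => !₂[fderiv ℝ H ζ (EuclideanSpace.single 1 1),
      -fderiv ℝ H ζ (EuclideanSpace.single 0 1)] := funext hf
    rw [this, differentiableAt_euclidean, Fin.forall_fin_two]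
    exact ⟨(happ _).differentiableAt, (happ _).neg.differentiableAt⟩
  have hc : ∀ i : Fin 2, HasFDerivAt (fun ζ => f ζ i)
      ((EuclideanSpace.proj i : Plane →L[ℝ] ℝ).comp (fderiv ℝ f ξ)) ξ := fun i =>
    (EuclideanSpace.proj i : Plane →L[ℝ] ℝ).hasFDerivAt.comp ξ hfd
  have h0 : HasFDerivAt (fun ζ => f ζ 0) ((fderiv ℝ (fderiv ℝ H) ξ).flip (EuclideanSpace.single 1 1)) ξ := by
    simpa [hf] using happ (EuclideanSpace.single 1 1)
  have h1 : HasFDerivAt (fun ζ => f ζ 1) (-(fderiv ℝ (fderiv ℝ H) ξ).flip (EuclideanSpace.single 0 1)) ξ := by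
    simpa [hf] using (happ (EuclideanSpace.single 0 1)).fun_neg
  have e0 := DFunLike.congr_fun ((hc 0).unique h0) (EuclideanSpace.single 0 1)
  have e1 := DFunLike.congr_fun ((hc 1).unique h1) (EuclideanSpace.single 1 1)
  simp at e0 e1
  unfold TraceZero
  rw [e0, e1, hs.eq (EuclideanSpace.single 0 1) (EuclideanSpace.single 1 1)]
  ring

end Hamiltonian

/-! ### Linearized and adjoint solutions -/

section Solutions

variable {f : Plane → Plane} {T : ℝ} {x₀ y z p q : ℝ → Plane}

lemma IsCycle.isLinearizedSolution_deriv (hx₀ : IsCycle f T x₀) (hf : ContDiff ℝ 1 f) :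
    IsLinearizedSolution f x₀ (deriv x₀) := by
  intro t
  have hd : deriv x₀ = fun s => f (x₀ s) := funext fun s => (hx₀.isSolution s).deriv
  rw [hd]
  exact ((hf.differentiable (by norm_num) (x₀ t)).hasFDerivAt).comp_hasDerivAt t (hx₀.isSolution t)

lemma IsCycle.periodic_deriv (hx₀ : IsCycle f T x₀) : Function.Periodic (deriv x₀) T := by
  intro t
  rw [(hx₀.isSolution _).deriv, (hx₀.isSolution _).deriv, hx₀.periodic t]

lemma IsLinearizedSolution.continuous (hy : IsLinearizedSolution f x₀ y) : Continuous y :=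
  continuous_iff_continuousAt.2 fun t => (hy t).continuousAt

lemma IsAdjointSolution.continuous (hz : IsAdjointSolution f x₀ z) : Continuous z :=
  continuous_iff_continuousAt.2 fun t => (hz t).continuousAt

lemma IsAdjointSolution.inner_eq (hz : IsAdjointSolution f x₀ z) (hy : IsLinearizedSolution f x₀ y)
    (s t : ℝ) : (inner ℝ (z s) (y s) : ℝ) = inner ℝ (z t) (y t) := by
  refine eq_of_hasDerivAt_zero (φ := fun t => inner ℝ (z t) (y t)) (fun t => ?_) s t
  have h := (hz t).inner ℝ (hy t)
  rwa [inner_neg_left, ContinuousLinearMap.adjoint_inner_left, add_neg_cancel] at h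

lemma IsAdjointSolution.det_eq (htr : ∀ ξ, TraceZero (fderiv ℝ f ξ))
    (hp : IsAdjointSolution f x₀ p) (hq : IsAdjointSolution f x₀ q)
    (s t : ℝ) : det₂ (p s) (q s) = det₂ (p t) (q t) := by
  refine eq_of_hasDerivAt_zero (φ := fun t => det₂ (p t) (q t)) (fun t => ?_) s t
  have h1 := hasDerivAt_plane.1 (hp t)
  have h2 := hasDerivAt_plane.1 (hq t)
  have h := (h1.1.mul h2.2).sub (h2.1.mul h1.2)
  refine h.congr_deriv ?_
  have := (htr (x₀ t)).det_adjoint (p t) (q t)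
  simp only [det₂] at this
  simp only [PiLp.neg_apply]
  linear_combination -this

/-- Pairings of adjoint with linearized solutions are constant, so for any linearized `y` the
difference `y(s+T) - y(s)` is orthogonal to every periodic adjoint solution. Two independent ones
would make every `y` periodic. -/
lemma IsAdjointSolution.not_both_periodic (htr : ∀ ξ, TraceZero (fderiv ℝ f ξ))
    (hnd : IsNondegenerate f T x₀)
    (hp : IsAdjointSolution f x₀ p) (hq : IsAdjointSolution f x₀ q)
    (hpT : Function.Periodic p T) (hqT : Function.Periodic q T) (t : ℝ) :
    det₂ (p t) (q t) = 0 := by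
  by_contra hne
  obtain ⟨y, hy, hyT⟩ := hnd
  refine hyT fun s => ?_
  have hd : det₂ (p s) (q s) ≠ 0 := by rwa [hp.det_eq htr hq s t]
  refine sub_eq_zero.1 (eq_zero_of_inner_eq_zero hd ?_ ?_)
  · rw [inner_sub_right, sub_eq_zero, ← hp.inner_eq hy (s + T) s, hpT s]
  · rw [inner_sub_right, sub_eq_zero, ← hq.inner_eq hy (s + T) s, hqT s]

lemma IsLinearizedSolution.isAdjointSolution_rot (htr : ∀ ξ, TraceZero (fderiv ℝ f ξ))
    (hy : IsLinearizedSolution f x₀ y) : IsAdjointSolution f x₀ (fun t => rot (y t)) := by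
  intro t
  rw [(htr (x₀ t)).adjoint_rot, neg_neg]
  exact HasDerivAt.rot (hy t)

lemma IsAdjointSolution.add_const (hz : IsAdjointSolution f x₀ z) (hx₀ : Function.Periodic x₀ T) :
    IsAdjointSolution f x₀ (fun t => z (t + T)) := by
  intro t
  have := (hz (t + T)).comp_add_const t T
  rwa [hx₀ t] at this

end Solutions

/-! ### Floquet structure of the adjoint system -/

section Floquet

/-- The relations between the adjoint solutions `zh`, `zt`, the velocity of the cycle and the
complementary solution `y` of the linearized system. -/
structure FloquetData (T : ℝ) (x₀ zh zt : ℝ → Plane) (κ : ℝ) : Prop where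
  det_ne_zero : ∀ t, det₂ (zh t) (zt t) ≠ 0
  inner_zh_deriv : ∀ t, inner ℝ (zh t) (deriv x₀ t) = (1 : ℝ)
  inner_zt_deriv : ∀ t, inner ℝ (zt t) (deriv x₀ t) = (0 : ℝ)
  coeff_ne_zero : κ ≠ 0
  zh_add_period : ∀ t, zh (t + T) = zh t + κ • zt t

variable {f : Plane → Plane} {T κ : ℝ} {x₀ zh zt : ℝ → Plane}

lemma exists_floquetData (hf : ContDiff ℝ 1 f) (htr : ∀ ξ, TraceZero (fderiv ℝ f ξ))
    (hx₀ : IsCycle f T x₀) (hnd : IsNondegenerate f T x₀)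
    (hzt : IsAdjointSolution f x₀ zt) (hztT : Function.Periodic zt T)
    (hzh : IsAdjointSolution f x₀ zh) (hlin : LinearIndependent ℝ ![zh, zt])
    (hnorm : inner ℝ (deriv x₀ 0) (zh 0) = (1 : ℝ)) : ∃ κ, FloquetData T x₀ zh zt κ := by
  have hv := hx₀.isLinearizedSolution_deriv hf
  have h1 : ∀ t, inner ℝ (zh t) (deriv x₀ t) = (1 : ℝ) := fun t => by
    rw [hzh.inner_eq hv t 0, real_inner_comm, hnorm]
  have hn := hv.isAdjointSolution_rot htr
  have hnT : Function.Periodic (fun t => rot (deriv x₀ t)) T := fun t => by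
    simp only [hx₀.periodic_deriv t]
  have h0 : ∀ t, inner ℝ (zt t) (deriv x₀ t) = (0 : ℝ) := fun t => by
    have h := hzt.not_both_periodic htr hnd hn hztT hnT t
    rw [inner_plane]
    simp only [det₂, rot_zero, rot_one] at h
    linear_combination h
  -- If the determinant vanished, `zt` would be parallel to `zh` at every time; being orthogonal to
  -- `ẋ₀` while `zh` is not, it would be zero.
  have hdet : ∀ t, det₂ (zh t) (zt t) ≠ 0 := fun t h => by
    have hz : zt = 0 := by
      funext s
      have hs : det₂ (zh s) (zt s) = 0 := by rw [hzh.det_eq htr hzt s t, h]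
      have a := h1 s
      have b := h0 s
      rw [inner_plane] at a b
      unfold det₂ at hs
      ext i
      fin_cases i
      · simp only [Fin.zero_eta, Pi.zero_apply, PiLp.zero_apply]
        linear_combination -zt s 0 * a - deriv x₀ s 1 * hs + zh s 0 * b
      · simp only [Fin.mk_one, Pi.zero_apply, PiLp.zero_apply]
        linear_combination -zt s 1 * a + deriv x₀ s 0 * hs + zh s 1 * b
    exact hlin.ne_zero 1 (by simp [hz])
  have hu := hzh.add_const hx₀.periodic
  -- The increment is orthogonal to `ẋ₀(t)`, hence a multiple of `zt(t)`. Taking the determinant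
  -- with `zh(t)` gives the factor, a quotient of two constant determinants.
  have hshift : ∀ t, zh (t + T) = zh t
      + (det₂ (zh 0) (zh (0 + T)) / det₂ (zh 0) (zt 0)) • zt t := fun t => by
    rw [hzh.det_eq htr hu 0 t, hzh.det_eq htr hzt 0 t]
    have a := h1 t
    have b := h0 t
    have c := h1 (t + T)
    rw [hx₀.periodic_deriv t] at c
    have hd := hdet t
    rw [inner_plane] at a b c
    have e0 : deriv x₀ t 0 = zt t 1 / det₂ (zh t) (zt t) := by
      rw [eq_div_iff hd]; unfold det₂
      linear_combination zt t 1 * a - zh t 1 * b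
    have e1 : deriv x₀ t 1 = -zt t 0 / det₂ (zh t) (zt t) := by
      rw [eq_div_iff hd]; unfold det₂
      linear_combination -zt t 0 * a + zh t 0 * b
    rw [e0, e1] at c
    have c' : zh (t + T) 0 * zt t 1 - zh (t + T) 1 * zt t 0 = det₂ (zh t) (zt t) := by
      field_simp at c
      linear_combination c
    ext i
    apply mul_left_cancel₀ hd
    have key : det₂ (zh t) (zt t) * (det₂ (zh t) (zh (t + T)) / det₂ (zh t) (zt t))
        = det₂ (zh t) (zh (t + T)) := mul_div_cancel₀ _ hd
    generalize det₂ (zh t) (zh (t + T)) / det₂ (zh t) (zt t) = k at key ⊢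
    unfold det₂ at c' key ⊢
    fin_cases i
    · simp only [Fin.zero_eta, PiLp.add_apply, PiLp.smul_apply, smul_eq_mul]
      linear_combination zh t 0 * c' - zt t 0 * key
    · simp only [Fin.mk_one, PiLp.add_apply, PiLp.smul_apply, smul_eq_mul]
      linear_combination zh t 1 * c' - zt t 1 * key
  refine ⟨_, hdet, h1, h0, fun hκ => ?_, hshift⟩
  -- With `κ = 0` both adjoint solutions would be periodic, although independent.
  refine hdet 0 (hzh.not_both_periodic htr hnd hzt (fun t => ?_) hztT 0)
  rw [hshift t, hκ, zero_smul, add_zero]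

lemma yFun_eq (htr : ∀ ξ, TraceZero (fderiv ℝ f ξ)) (hzt : IsAdjointSolution f x₀ zt)
    (hzh : IsAdjointSolution f x₀ zh) (t : ℝ) :
    yFun zh zt t = (det₂ (zh 0) (zt 0))⁻¹ • rot (zh t) := by
  rw [hzh.det_eq htr hzt 0 t]
  ext i
  fin_cases i <;> simp [yFun] <;> ring

lemma isLinearizedSolution_yFun (htr : ∀ ξ, TraceZero (fderiv ℝ f ξ))
    (hzt : IsAdjointSolution f x₀ zt) (hzh : IsAdjointSolution f x₀ zh) :
    IsLinearizedSolution f x₀ (yFun zh zt) := by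
  intro t
  rw [yFun_eq htr hzt hzh, map_smul]
  rw [funext (yFun_eq htr hzt hzh)]
  have h := (HasDerivAt.rot (hzh t)).const_smul (det₂ (zh 0) (zt 0))⁻¹
  have e : rot (-(ContinuousLinearMap.adjoint (fderiv ℝ f (x₀ t))) (zh t))
      = fderiv ℝ f (x₀ t) (rot (zh t)) := by
    rw [← neg_neg (fderiv ℝ f (x₀ t) (rot (zh t))), ← (htr (x₀ t)).rot_adjoint]
    ext i
    fin_cases i <;> simp
  rwa [e] at h

namespace FloquetData

lemma gam_eq (h : FloquetData T x₀ zh zt κ) {ts : ℝ} (hts : zt ts 0 = 0) :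
    gam T zh zt ts = κ⁻¹ := by
  have hne : zt ts 1 ≠ 0 := fun h1 => h.det_ne_zero ts (by simp [det₂, hts, h1])
  have hκ := h.coeff_ne_zero
  unfold gam
  rw [add_comm T ts, h.zh_add_period]
  simp
  field_simp

/-- The vectors `ẋ₀(t), y(t)` form the basis dual to `zh(t), zt(t)`. -/
lemma decomp (h : FloquetData T x₀ zh zt κ) (t : ℝ) (v : Plane) :
    v = (inner ℝ (zh t) v : ℝ) • deriv x₀ t + (inner ℝ (zt t) v : ℝ) • yFun zh zt t := by
  have hd := h.det_ne_zero t
  refine sub_eq_zero.1 (eq_zero_of_inner_eq_zero hd ?_ ?_)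
  · have : (inner ℝ (zh t) (yFun zh zt t) : ℝ) = 0 := by
      rw [inner_plane]; simp [yFun]; ring
    rw [inner_sub_right, inner_add_right, inner_smul_right, inner_smul_right, h.inner_zh_deriv,
      this]
    ring
  · have : (inner ℝ (zt t) (yFun zh zt t) : ℝ) = 1 := by
      rw [inner_plane]; simp [yFun]; field_simp; unfold det₂; ring
    rw [inner_sub_right, inner_add_right, inner_smul_right, inner_smul_right, h.inner_zt_deriv,
      this]
    ring

lemma not_periodic_yFun (h : FloquetData T x₀ zh zt κ) (htr : ∀ ξ, TraceZero (fderiv ℝ f ξ))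
    (hzt : IsAdjointSolution f x₀ zt) (hzh : IsAdjointSolution f x₀ zh) :
    ¬ Function.Periodic (yFun zh zt) T := by
  intro hy
  have h0 := hy 0
  rw [yFun_eq htr hzt hzh, yFun_eq htr hzt hzh] at h0
  have h1 := smul_right_injective Plane (inv_ne_zero (h.det_ne_zero 0)) h0
  have hz : zh (0 + T) = zh 0 := by
    ext i
    fin_cases i
    · simpa using congrArg (fun v : Plane => v 1) h1
    · simpa using congrArg (fun v : Plane => v 0) h1
  rw [h.zh_add_period, add_eq_left, smul_eq_zero] at hz
  rcases hz with hz | hz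
  · exact h.coeff_ne_zero hz
  · exact h.det_ne_zero 0 (by simp [det₂, hz])

end FloquetData

end Floquet

end PlanarCycle

/-! ### Measurable metric projection onto convex-valued maps -/

section Projection

open Metric

/-- A closed ball about `v` disjoint from `G a ∩ C` stays disjoint from `G a' ∩ C` for nearby `a'`;
moving `v` slightly costs only `c₂ - c₁`. The extended distance also covers empty intersections,
where it is `∞`. -/
lemma UpperHemicontinuous.lowerSemicontinuous_infEDist {α E : Type*} [TopologicalSpace α]
    [PseudoEMetricSpace E] {G : α → Set E} (hG : UpperHemicontinuous G) {C : Set E}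
    (hC : IsClosed C) : LowerSemicontinuous (fun p : α × E => infEDist p.2 (G p.1 ∩ C)) := by
  rintro ⟨a, v⟩ c hc
  obtain ⟨c₁, hc₁, h₁⟩ := exists_between hc
  obtain ⟨c₂, hc₂, h₂⟩ := exists_between h₁
  have hU : IsOpen (C ∩ closedEBall v c₂)ᶜ := (hC.inter isClosed_closedEBall).isOpen_compl
  have hsub : G a ⊆ (C ∩ closedEBall v c₂)ᶜ := fun w hw hw' =>
    (disjoint_left.1 (disjoint_closedEBall_of_lt_infEDist h₂)) hw'.2 ⟨hw, hw'.1⟩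
  have hev : ∀ᶠ a' in 𝓝 a, G a' ⊆ (C ∩ closedEBall v c₂)ᶜ :=
    hG.forall_isOpen a _ hU hsub
  have hball : ∀ᶠ v' in 𝓝 v, edist v' v < c₂ - c₁ :=
    eball_mem_nhds v (tsub_pos_of_lt hc₂)
  filter_upwards [hev.prod_nhds hball] with p hp
  refine hc₁.trans_le (le_infEDist.2 fun w hw => ?_)
  have hw' : c₂ < edist w v := by
    by_contra hcon
    exact hp.1 hw.1 ⟨hw.2, not_lt.1 hcon⟩
  have htri : c₂ ≤ edist p.2 w + (c₂ - c₁) :=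
    calc c₂ ≤ edist w v := hw'.le
      _ ≤ edist w p.2 + edist p.2 v := edist_triangle _ _ _
      _ ≤ edist p.2 w + (c₂ - c₁) := by rw [edist_comm w]; gcongr; exact hp.2.le
  have hfin : c₂ - c₁ ≠ ∞ := ENNReal.sub_ne_top h₂.ne_top
  have h3 : c₁ + (c₂ - c₁) ≤ edist p.2 w + (c₂ - c₁) := by
    rwa [add_tsub_cancel_of_le hc₂.le]
  exact (ENNReal.add_le_add_iff_right hfin).1 h3

/-- Adding the variational inequalities of the two nearest points gives `‖q - p‖² ≤ 0`. -/
lemma Convex.eq_of_dist_eq_infDist {E : Type*} [NormedAddCommGroup E] [InnerProductSpace ℝ E]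
    {K : Set E} (hK : Convex ℝ K) {u p q : E} (hp : p ∈ K) (hq : q ∈ K)
    (hpd : dist u p = infDist u K) (hqd : dist u q = infDist u K) : p = q := by
  have key : ∀ {v : E}, v ∈ K → dist u v = infDist u K → ∀ w ∈ K, inner ℝ (u - v) (w - v) ≤ (0 : ℝ) := by
    intro v hv hd
    refine (norm_eq_iInf_iff_real_inner_le_zero hK hv).1 ?_
    rw [← dist_eq_norm, hd, infDist_eq_iInf]
    simp only [dist_eq_norm]
  have h1 := key hp hpd q hq
  have h2 := key hq hqd p hp
  have h3 : inner ℝ (q - p) (q - p) ≤ (0 : ℝ) := by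
    have e : (inner ℝ (q - p) (q - p) : ℝ) = inner ℝ (u - p) (q - p) + inner ℝ (u - q) (p - q) := by
      rw [← neg_sub q p, inner_neg_right, ← sub_eq_add_neg, ← inner_sub_left]
      congr 1
      abel
    rw [e]; linarith
  exact (sub_eq_zero.1 (real_inner_self_nonpos.1 h3)).symm

/-- The metric projection of a measurable function onto an upper hemicontinuous family of nonempty
compact convex sets is measurable. -/
lemma UpperHemicontinuous.exists_measurable_infDist_eq {α E : Type*} [TopologicalSpace α]
    [MeasurableSpace α] [BorelSpace α] [SecondCountableTopology α]
    [NormedAddCommGroup E] [InnerProductSpace ℝ E]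
    [MeasurableSpace E] [BorelSpace E] [SecondCountableTopology E]
    {G : α → Set E} (hG : UpperHemicontinuous G)
    (hne : ∀ a, (G a).Nonempty) (hcpt : ∀ a, IsCompact (G a)) (hconv : ∀ a, Convex ℝ (G a))
    {u : α → E} (hu : Measurable u) :
    ∃ P : α → E, Measurable P ∧ (∀ a, P a ∈ G a) ∧ ∀ a, infDist (u a) (G a) = dist (u a) (P a) := by
  choose P hPG hPd using fun a => (hcpt a).exists_infDist_eq_dist (hne a) (u a)
  suffices hP : Measurable P from ⟨P, hP, hPG, hPd⟩
  refine measurable_of_isClosed fun C hC => ?_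
  have hmeas : ∀ D : Set E, IsClosed D → Measurable fun a => infEDist (u a) (G a ∩ D) := by
    intro D hD
    have h1 : Measurable (fun p : α × E => infEDist p.2 (G p.1 ∩ D)) :=
      (hG.lowerSemicontinuous_infEDist hD).measurable
    have h2 : Measurable (fun a => (a, u a)) := measurable_id.prodMk hu
    have h3 := h1.comp h2
    rwa [Function.comp_def] at h3
  -- By uniqueness, the nearest point lies in `C` exactly when restricting to `C` does not increase
  -- the distance.
  have heq : P ⁻¹' C = {a | infEDist (u a) (G a ∩ C) ≤ infEDist (u a) (G a ∩ univ)} := by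
    ext a
    have hPe : edist (u a) (P a) = infEDist (u a) (G a) := by
      rw [edist_dist, ← hPd, infDist, ENNReal.ofReal_toReal (infEDist_ne_top (hne a))]
    simp only [inter_univ, mem_preimage, mem_ofPred_eq]
    constructor
    · intro h
      rw [← hPe]
      exact infEDist_le_edist_of_mem ⟨hPG a, h⟩
    · intro h
      have hne' : (G a ∩ C).Nonempty := by
        by_contra hcon
        rw [not_nonempty_iff_eq_empty] at hcon
        rw [hcon, infEDist_empty, top_le_iff] at h
        exact infEDist_ne_top (hne a) h
      obtain ⟨q, hq, hqd⟩ := ((hcpt a).inter_right hC).exists_infEDist_eq_edist hne' (u a)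
      have hqe : dist (u a) q = infDist (u a) (G a) := by
        refine le_antisymm ?_ (infDist_le_dist_of_mem hq.1)
        rw [infDist, dist_edist]
        exact ENNReal.toReal_mono (infEDist_ne_top (hne a)) (hqd ▸ h)
      rw [(hconv a).eq_of_dist_eq_infDist (hPG a) hq.1 (hPd a).symm hqe]
      exact hq.2
  rw [heq]
  exact measurableSet_le (hmeas C hC) (hmeas univ isClosed_univ)

end Projection

/-! ### Absolutely continuous functions -/

section AbsolutelyContinuous

namespace AbsolutelyContinuousOnInterval

variable {X Y : Type*} [PseudoMetricSpace X] [PseudoMetricSpace Y] {a b c : ℝ}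

lemma of_dist_le {u : ℝ → X} {v : ℝ → Y} (hu : AbsolutelyContinuousOnInterval u a b)
    (h : ∀ s t, dist (v s) (v t) ≤ dist (u s) (u t)) : AbsolutelyContinuousOnInterval v a b := by
  rw [absolutelyContinuousOnInterval_iff] at hu ⊢
  intro ε hε
  obtain ⟨δ, hδ, H⟩ := hu ε hε
  exact ⟨δ, hδ, fun E hE hEδ => (Finset.sum_le_sum fun i _ => h _ _).trans_lt (H E hE hEδ)⟩

lemma comp_add_const {u : ℝ → X} (hu : AbsolutelyContinuousOnInterval u (a + c) (b + c)) :
    AbsolutelyContinuousOnInterval (fun t => u (t + c)) a b := by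
  rw [absolutelyContinuousOnInterval_iff] at hu ⊢
  intro ε hε
  obtain ⟨δ, hδ, H⟩ := hu ε hε
  refine ⟨δ, hδ, fun E hE hEδ => ?_⟩
  refine H (E.1, fun i => ((E.2 i).1 + c, (E.2 i).2 + c)) ⟨fun i hi => ?_, ?_⟩ (by simpa using hEδ)
  · have := hE.1 i hi
    simp only [mem_uIcc] at this ⊢
    constructor
    · rcases this.1 with h | h
      · left; constructor <;> linarith
      · right; constructor <;> linarith
    · rcases this.2 with h | h
      · left; constructor <;> linarith
      · right; constructor <;> linarith
  · intro i hi j hj hij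
    have := hE.2 hi hj hij
    simp only [Function.onFun, disjoint_left, mem_uIoc] at this ⊢
    intro s hs hs'
    refine this (a := s - c) ?_ ?_
    · rcases hs with h | h
      · left; constructor <;> linarith
      · right; constructor <;> linarith
    · rcases hs' with h | h
      · left; constructor <;> linarith
      · right; constructor <;> linarith

lemma of_hasDerivAt {E : Type*} [NormedAddCommGroup E] [NormedSpace ℝ E] {u u' : ℝ → E}
    (hu : ∀ t, HasDerivAt u (u' t) t) (hc : Continuous u') (a b : ℝ) :
    AbsolutelyContinuousOnInterval u a b := by
  have : ContDiff ℝ 1 u := by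
    rw [contDiff_one_iff_deriv]
    exact ⟨fun t => (hu t).differentiableAt, by rwa [funext fun t => (hu t).deriv]⟩
  exact this.contDiffOn.absolutelyContinuousOnInterval

lemma continuous_of_forall {E : Type*} [SeminormedAddCommGroup E] {u : ℝ → E}
    (hu : ∀ a b, AbsolutelyContinuousOnInterval u a b) :
    Continuous u := by
  rw [continuous_iff_continuousAt]
  intro t
  have hmem : uIcc (t - 1) (t + 1) ∈ 𝓝 t := by
    rw [uIcc_of_le (by linarith)]
    exact Icc_mem_nhds (by linarith) (by linarith)
  have hc : ContinuousOn u (uIcc (t - 1) (t + 1)) := (hu (t - 1) (t + 1)).continuousOn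
  exact hc.continuousAt hmem

end AbsolutelyContinuousOnInterval

end AbsolutelyContinuous

/-! ### Lagrange identity and the a priori estimate -/

namespace PlanarCycle

/-- Integrated Lagrange identity for `ẇ = A(t) w + v(t)` and the adjoint system. -/
lemma inner_sub_inner_eq_integral {A : ℝ → Plane →L[ℝ] Plane} {z w v : ℝ → Plane} {a b : ℝ}
    (hz : ∀ t, HasDerivAt z (-(ContinuousLinearMap.adjoint (A t) (z t))) t)
    (hzac : AbsolutelyContinuousOnInterval z a b) (hwac : AbsolutelyContinuousOnInterval w a b)
    (hw : ∀ᵐ t, HasDerivAt w (A t (w t) + v t) t) :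
    (inner ℝ (z b) (w b) : ℝ) - inner ℝ (z a) (w a) = ∫ t in a..b, (inner ℝ (z t) (v t) : ℝ) := by
  have hcoord : ∀ {u : ℝ → Plane}, AbsolutelyContinuousOnInterval u a b → ∀ i : Fin 2,
      AbsolutelyContinuousOnInterval (fun t => u t i) a b := fun {u} hu i =>
    hu.of_dist_le fun s t => by
      simpa only [dist_eq_norm, PiLp.sub_apply] using PiLp.norm_apply_le (u s - u t) i
  have hac : AbsolutelyContinuousOnInterval (fun t => (inner ℝ (z t) (w t) : ℝ)) a b := by
    have h := ((hcoord hzac 0).mul (hcoord hwac 0)).add ((hcoord hzac 1).mul (hcoord hwac 1))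
    convert! h using 1
    funext t
    exact inner_plane _ _
  rw [← hac.integral_deriv_eq_sub]
  refine intervalIntegral.integral_congr_ae ?_
  filter_upwards [hw] with t ht _
  have h := ((hz t).inner ℝ ht).deriv
  rw [h, inner_neg_left, ContinuousLinearMap.adjoint_inner_left, inner_add_right]
  ring

/-- Mean value inequality, with `f'` varying by less than `η` on `δ`-balls centred in the compact
set. -/
lemma exists_linearization_bound {f : Plane → Plane} (hf : ContDiff ℝ 1 f) {K : Set Plane}
    (hK : IsCompact K) {η : ℝ} (hη : 0 < η) :
    ∃ δ > 0, ∀ ξ ∈ K, ∀ v : Plane, ‖v‖ < δ → ‖f (ξ + v) - f ξ - fderiv ℝ f ξ v‖ ≤ η * ‖v‖ := by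
  have hc : Continuous (fderiv ℝ f) := hf.continuous_fderiv (by norm_num)
  have hU := hK.uniformContinuousAt_of_continuousAt (fderiv ℝ f) (fun a _ => hc.continuousAt)
    (Metric.dist_mem_uniformity hη)
  obtain ⟨δ, hδ, H⟩ := Metric.mem_uniformity_dist.1 hU
  refine ⟨δ, hδ, fun ξ hξ v hv => ?_⟩
  have h := (convex_ball ξ δ).norm_image_sub_le_of_norm_fderiv_le' (f := f) (𝕜 := ℝ)
    (φ := fderiv ℝ f ξ) (C := η)
    (fun y _ => hf.differentiable (by norm_num) y) (fun y hy => ?_)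
    (Metric.mem_ball_self hδ) (y := ξ + v) (by simpa using hv)
  · simpa using h
  · have := H (a := ξ) (b := y) (by rw [dist_comm]; exact hy) hξ
    rw [← dist_eq_norm, dist_comm]
    exact le_of_lt this

section Estimate

variable {f : Plane → Plane} {T κ : ℝ} {x₀ zh zt : ℝ → Plane}

lemma norm_integral_inner_le {z h : ℝ → Plane} {a b Cz R : ℝ} (hCz : 0 ≤ Cz)
    (ha : a ∈ Icc (-T) T) (hb : b ∈ Icc (-T) T) (hz : ∀ t ∈ Icc (-T) T, ‖z t‖ ≤ Cz)
    (hh : ∀ᵐ t, t ∈ Icc (-T) T → ‖h t‖ ≤ R) :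
    |∫ t in a..b, (inner ℝ (z t) (h t) : ℝ)| ≤ Cz * R * |b - a| := by
  rw [← Real.norm_eq_abs]
  refine intervalIntegral.norm_integral_le_of_norm_le_const_ae ?_
  filter_upwards [hh] with t ht hta
  have hmem : t ∈ Icc (-T) T := uIcc_subset_Icc ha hb (uIoc_subset_uIcc hta)
  exact (norm_inner_le_norm _ _).trans
    (mul_le_mul (hz t hmem) (ht hmem) (norm_nonneg _) hCz)

lemma intervalIntegrable_inner {z h : ℝ → Plane} {a b R : ℝ} (hz : Continuous z)
    (ha : a ∈ Icc (-T) T) (hb : b ∈ Icc (-T) T) (hm : AEStronglyMeasurable h volume)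
    (hh : ∀ᵐ t, t ∈ Icc (-T) T → ‖h t‖ ≤ R) :
    IntervalIntegrable (fun t => (inner ℝ (z t) (h t) : ℝ)) volume a b := by
  obtain ⟨C, hC⟩ := isCompact_Icc.exists_bound_of_continuousOn (s := Icc (-T) T) hz.continuousOn
  have hC0 : 0 ≤ C := (norm_nonneg _).trans (hC a ha)
  have hint : IntegrableOn (fun t => (inner ℝ (z t) (h t) : ℝ)) (Icc (-T) T) volume := by
    refine Measure.integrableOn_of_bounded (M := C * R) (by simp)
      (hz.aestronglyMeasurable.inner hm) ?_
    rw [ae_restrict_iff' measurableSet_Icc]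
    filter_upwards [hh] with t ht hmem
    exact (norm_inner_le_norm _ _).trans (mul_le_mul (hC t hmem) (ht hmem) (norm_nonneg _) hC0)
  exact (hint.mono_set (uIcc_subset_Icc ha hb)).intervalIntegrable

/-- The constants depend neither on `ε` nor on `w`. The maximum `W` of `‖w‖` is bounded by `C₁(ηW +
εK)`; small `η` absorbs the first term, so `W = O(ε)` and the remainder contributes `O(ηε)`. -/
lemma FloquetData.exists_estimate (fl : FloquetData T x₀ zh zt κ) (hT : 0 < T)
    (hzh : Continuous zh) (hztT : Function.Periodic zt T)
    (hv : Continuous (deriv x₀)) (hy : Continuous (yFun zh zt)) {K : ℝ} (hK : 0 ≤ K) :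
    ∃ η₀ > 0, ∃ C, 0 ≤ C ∧ ∀ ε > 0, ∀ η, 0 ≤ η → η ≤ η₀ → ∀ w r h : ℝ → Plane,
      Continuous w → Function.Periodic w T → Continuous r → (∀ t, ‖r t‖ ≤ η * ‖w t‖) →
      AEStronglyMeasurable h volume → (∀ᵐ t, t ∈ Icc (-T) T → ‖h t‖ ≤ K) →
      (∀ a b, (inner ℝ (zh b) (w b) : ℝ) - inner ℝ (zh a) (w a)
        = ∫ t in a..b, (inner ℝ (zh t) (r t + ε • h t) : ℝ)) →
      (inner ℝ (zh 0) (w 0) : ℝ) = 0 →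
      ∀ t ∈ Icc 0 T, |(inner ℝ (zt t) (w t) : ℝ)
        - ε * (κ⁻¹ * ∫ τ in (t - T)..t, (inner ℝ (zh τ) (h τ) : ℝ))| ≤ C * η * ε := by
  obtain ⟨Cz, hCz⟩ := isCompact_Icc.exists_bound_of_continuousOn (s := Icc (-T) T) hzh.continuousOn
  obtain ⟨Cv, hCv⟩ := isCompact_Icc.exists_bound_of_continuousOn (s := Icc 0 T) hv.continuousOn
  obtain ⟨Cy, hCy⟩ := isCompact_Icc.exists_bound_of_continuousOn (s := Icc 0 T) hy.continuousOn
  have h00 : (0 : ℝ) ∈ Icc 0 T := ⟨le_rfl, hT.le⟩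
  have h0T : (0 : ℝ) ∈ Icc (-T) T := ⟨by linarith, hT.le⟩
  have hCz0 := (norm_nonneg _).trans (hCz 0 h0T)
  have hCv0 := (norm_nonneg _).trans (hCv 0 h00)
  have hCy0 := (norm_nonneg _).trans (hCy 0 h00)
  have hκ : 0 < |κ|⁻¹ := inv_pos.2 (abs_pos.2 fl.coeff_ne_zero)
  set C₁ : ℝ := T * Cz * (Cv + |κ|⁻¹ * Cy) with hC₁
  have hC₁0 : 0 ≤ C₁ := by positivity
  -- The threshold ensures `C₁η ≤ 1/2`; the constant comes from inserting `W ≤ 2C₁Kε` into the bound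
  -- `|κ|⁻¹ T Cz ηW`.
  refine ⟨1 / (2 * (C₁ + 1)), by positivity, |κ|⁻¹ * (T * Cz * (2 * C₁ * K)), by positivity, ?_⟩
  intro ε hε η hη0 hη w r h hw hwT hr hrw hh hhK hid hw0
  obtain ⟨tm, htm, hmax⟩ := isCompact_Icc.exists_isMaxOn ⟨0, h00⟩ hw.norm.continuousOn
  have hW : ∀ t, ‖w t‖ ≤ ‖w tm‖ := fun t => by
    obtain ⟨s, hs, hts⟩ := hwT.exists_mem_Ico₀ hT t
    rw [hts]
    exact hmax (Ico_subset_Icc_self hs)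
  set W := ‖w tm‖ with hWdef
  have hW0 : 0 ≤ W := norm_nonneg _
  have hrW : ∀ᵐ t, t ∈ Icc (-T) T → ‖r t‖ ≤ η * W :=
    ae_of_all _ fun t _ => (hrw t).trans (by gcongr; exact hW t)
  have hint : ∀ a ∈ Icc (-T) T, ∀ b ∈ Icc (-T) T,
      (∫ t in a..b, (inner ℝ (zh t) (r t + ε • h t) : ℝ))
      = (∫ t in a..b, (inner ℝ (zh t) (r t) : ℝ)) + ε * ∫ t in a..b, (inner ℝ (zh t) (h t) : ℝ) := by
    intro a ha b hb
    rw [← intervalIntegral.integral_const_mul, ← intervalIntegral.integral_add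
      ((hzh.inner hr).intervalIntegrable _ _)
      ((intervalIntegrable_inner hzh ha hb hh hhK).const_mul ε)]
    simp only [inner_add_right, inner_smul_right]
  have hzt : ∀ t ∈ Icc 0 T, |κ * (inner ℝ (zt t) (w t) : ℝ)
      - ε * ∫ τ in (t - T)..t, (inner ℝ (zh τ) (h τ) : ℝ)| ≤ T * Cz * (η * W) := by
    intro t ht
    have ha : t - T ∈ Icc (-T) T := ⟨by linarith [ht.1], by linarith [ht.2]⟩
    have hb : t ∈ Icc (-T) T := ⟨by linarith [ht.1], ht.2⟩
    -- Over one period `w` returns, so the boundary terms combine to `⟨zh(t) - zh(t-T), w(t)⟩ =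
    -- κ⟨zt(t), w(t)⟩`.
    have e := hid (t - T) t
    rw [hint _ ha _ hb, hwT.sub_eq t, ← inner_sub_left] at e
    have hz : zh t - zh (t - T) = κ • zt t := by
      have := fl.zh_add_period (t - T)
      rw [sub_add_cancel, hztT.sub_eq t] at this
      rw [this]; abel
    rw [hz, real_inner_smul_left] at e
    rw [e, add_sub_cancel_right]
    refine (norm_integral_inner_le hCz0 ha hb hCz hrW).trans (le_of_eq ?_)
    rw [sub_sub_cancel, abs_of_pos hT]; ring
  have hzt' : ∀ t ∈ Icc 0 T, |(inner ℝ (zt t) (w t) : ℝ)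
      - ε * (κ⁻¹ * ∫ τ in (t - T)..t, (inner ℝ (zh τ) (h τ) : ℝ))| ≤ |κ|⁻¹ * (T * Cz * (η * W)) := by
    intro t ht
    have e : (inner ℝ (zt t) (w t) : ℝ)
      - ε * (κ⁻¹ * ∫ τ in (t - T)..t, (inner ℝ (zh τ) (h τ) : ℝ))
      = κ⁻¹ * (κ * (inner ℝ (zt t) (w t) : ℝ)
      - ε * ∫ τ in (t - T)..t, (inner ℝ (zh τ) (h τ) : ℝ)) := by
      have := fl.coeff_ne_zero
      field_simp
    rw [e, abs_mul, abs_inv]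
    gcongr
    exact hzt t ht
  have hzhb : |(inner ℝ (zh tm) (w tm) : ℝ)| ≤ T * Cz * (η * W + ε * K) := by
    have hb : tm ∈ Icc (-T) T := ⟨by linarith [htm.1], htm.2⟩
    -- The normalization at time `0` removes the lower boundary term.
    have e := hid 0 tm
    rw [hint _ h0T _ hb, hw0, sub_zero] at e
    have i1 := norm_integral_inner_le hCz0 h0T hb hCz hrW
    have i2 := norm_integral_inner_le hCz0 h0T hb hCz hhK
    rw [sub_zero, abs_of_nonneg htm.1] at i1 i2
    rw [e]
    calc _ ≤ |∫ t in 0..tm, (inner ℝ (zh t) (r t) : ℝ)|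
          + |ε * ∫ t in 0..tm, (inner ℝ (zh t) (h t) : ℝ)| := abs_add_le _ _
      _ ≤ Cz * (η * W) * T + ε * (Cz * K * T) := by
          rw [abs_mul, abs_of_pos hε]
          gcongr
          · exact i1.trans (by gcongr; exact htm.2)
          · exact i2.trans (by gcongr; exact htm.2)
      _ = T * Cz * (η * W + ε * K) := by ring
  have hztb : |(inner ℝ (zt tm) (w tm) : ℝ)| ≤ |κ|⁻¹ * (T * Cz * (η * W + ε * K)) := by
    have ha : tm - T ∈ Icc (-T) T := ⟨by linarith [htm.1], by linarith [htm.2]⟩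
    have hb : tm ∈ Icc (-T) T := ⟨by linarith [htm.1], htm.2⟩
    have i2 := norm_integral_inner_le hCz0 ha hb hCz hhK
    rw [sub_sub_cancel, abs_of_pos hT] at i2
    have i1 := hzt' tm htm
    have i3 : |ε * (κ⁻¹ * ∫ τ in (tm - T)..tm, (inner ℝ (zh τ) (h τ) : ℝ))|
        ≤ ε * (|κ|⁻¹ * (Cz * K * T)) := by
      rw [abs_mul, abs_mul, abs_inv, abs_of_pos hε]
      gcongr
    have i4 := abs_sub_abs_le_abs_sub (inner ℝ (zt tm) (w tm) : ℝ)
      (ε * (κ⁻¹ * ∫ τ in (tm - T)..tm, (inner ℝ (zh τ) (h τ) : ℝ)))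
    linear_combination i1 + i3 + i4
  have hWle : W ≤ C₁ * (η * W + ε * K) := by
    calc W = ‖(inner ℝ (zh tm) (w tm) : ℝ) • deriv x₀ tm
            + (inner ℝ (zt tm) (w tm) : ℝ) • yFun zh zt tm‖ := by rw [← fl.decomp]
      _ ≤ |(inner ℝ (zh tm) (w tm) : ℝ)| * ‖deriv x₀ tm‖
            + |(inner ℝ (zt tm) (w tm) : ℝ)| * ‖yFun zh zt tm‖ := by
          refine (norm_add_le _ _).trans (le_of_eq ?_)
          rw [norm_smul, norm_smul, Real.norm_eq_abs, Real.norm_eq_abs]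
      _ ≤ (T * Cz * (η * W + ε * K)) * Cv + (|κ|⁻¹ * (T * Cz * (η * W + ε * K))) * Cy := by
          gcongr
          · exact hCv tm htm
          · exact hCy tm htm
      _ = C₁ * (η * W + ε * K) := by rw [hC₁]; ring
  have hηC : C₁ * η ≤ 1 / 2 := by
    calc C₁ * η ≤ (C₁ + 1) * (1 / (2 * (C₁ + 1))) := by gcongr; linarith
      _ = 1 / 2 := by field_simp
  have hWε : W ≤ 2 * C₁ * K * ε := by nlinarith [mul_le_mul_of_nonneg_right hηC hW0]
  intro t ht
  calc _ ≤ |κ|⁻¹ * (T * Cz * (η * W)) := hzt' t ht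
    _ ≤ |κ|⁻¹ * (T * Cz * (η * (2 * C₁ * K * ε))) := by gcongr
    _ = _ := by ring

end Estimate

end PlanarCycle

namespace PlanarCycle

/-! ### Uniform closeness and the choice of the shift -/

section Convergence

variable {x : ℝ → ℝ → Plane} {x₀ : ℝ → Plane} {T : ℝ} {l : Filter ℝ}

lemma eventually_forall_norm_sub_lt (hT : 0 < T) (hx₀ : Function.Periodic x₀ T)
    (hx : ∀ᶠ ε in l, Function.Periodic (x ε) T) (hconv : TendstoUniformlyOn x x₀ l (Icc 0 T))
    {δ : ℝ} (hδ : 0 < δ) : ∀ᶠ ε in l, ∀ t, ‖x ε t - x₀ t‖ < δ := by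
  filter_upwards [hx, Metric.tendstoUniformlyOn_iff.1 hconv δ hδ] with ε hε hd t
  have hper : Function.Periodic (fun t => x ε t - x₀ t) T := fun t => by
    simp only [hε t, hx₀ t]
  obtain ⟨s, hs, hts⟩ := hper.exists_mem_Ico₀ hT t
  have hts' : x ε t - x₀ t = x ε s - x₀ s := hts
  rw [hts', ← dist_eq_norm, dist_comm]
  exact hd s (Ico_subset_Icc_self hs)

/-- Zeros near `0` of perturbations of a function with derivative `1` at `0`. -/
lemma exists_tendsto_zero_of_hasDerivAt {φ : ℝ → ℝ → ℝ} {φ₀ : ℝ → ℝ}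
    (hφ₀ : φ₀ 0 = 0) (hd : HasDerivAt φ₀ 1 0) (hcont : ∀ᶠ ε in l, Continuous (φ ε))
    (hunif : ∀ δ > 0, ∀ᶠ ε in l, ∀ t, |φ ε t - φ₀ t| < δ) :
    ∃ Δ : ℝ → ℝ, Tendsto Δ l (𝓝 0) ∧ ∀ᶠ ε in l, φ ε (Δ ε) = 0 := by
  obtain ⟨s, hs, hlin⟩ : ∃ s > 0, ∀ t, |t| ≤ s → |φ₀ t - t| ≤ |t| / 2 := by
    have h := (hasDerivAt_iff_isLittleO_nhds_zero.1 hd).def (c := 1 / 2) (by norm_num)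
    obtain ⟨s, hs, H⟩ := Metric.eventually_nhds_iff.1 h
    refine ⟨s / 2, by positivity, fun t ht => ?_⟩
    have := H (y := t) (by rw [Real.dist_eq, sub_zero]; linarith)
    simp only [zero_add, hφ₀, sub_zero, smul_eq_mul, mul_one, Real.norm_eq_abs] at this
    linarith
  have hex : ∀ᶠ ε in l, ∃ t, |t| ≤ s ∧ φ ε t = 0 := by
    filter_upwards [hcont, hunif (s / 2) (by positivity)] with ε hc hu
    have a1 := abs_le.1 (hlin s (by rw [abs_of_pos hs]))
    have a2 := abs_le.1 (hlin (-s) (by rw [abs_neg, abs_of_pos hs]))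
    rw [abs_neg] at a2
    rw [abs_of_pos hs] at a1 a2
    have b1 := abs_lt.1 (hu s)
    have b2 := abs_lt.1 (hu (-s))
    obtain ⟨t, ht, h0⟩ := intermediate_value_Icc (by linarith : -s ≤ s) hc.continuousOn
      (show (0 : ℝ) ∈ Icc (φ ε (-s)) (φ ε s) from ⟨by linarith, by linarith⟩)
    exact ⟨t, abs_le.2 ht, h0⟩
  classical
  refine ⟨fun ε => if h : ∃ t, |t| ≤ s ∧ φ ε t = 0 then h.choose else 0, ?_, ?_⟩
  · rw [Metric.tendsto_nhds]
    intro e he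
    filter_upwards [hex, hunif (e / 2) (by positivity)] with ε h hu
    rw [dif_pos h, Real.dist_eq, sub_zero]
    -- At a zero `t` of `φ ε` the value `φ₀ t` is below `e/2` in modulus, and `|t| ≤ 2|φ₀ t|` on
    -- `[-s, s]`.
    have h1 := hlin _ h.choose_spec.1
    have h2 := hu h.choose
    rw [h.choose_spec.2, zero_sub, abs_neg] at h2
    have h3 := abs_sub_abs_le_abs_sub h.choose (φ₀ h.choose)
    rw [abs_sub_comm] at h3
    linarith
  · filter_upwards [hex] with ε h
    rw [dif_pos h]
    exact h.choose_spec.2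

lemma ae_comp_add_right {P : ℝ → Prop} (h : ∀ᵐ t, P t) (c : ℝ) : ∀ᵐ t, P (t + c) :=
  (measurePreserving_add_right volume c).quasiMeasurePreserving.ae h

end Convergence

/-! ### The multivalued perturbation along the cycle -/

section Multivalued

open Metric

variable {g : ℝ → Plane → ℝ → Set Plane} {x₀ : ℝ → Plane} {T K : ℝ}

lemma ConditionH.exists_ae_bound (hg : ConditionH g) (a b R : ℝ) :
    ∃ K, 0 ≤ K ∧ ∀ᵐ t, t ∈ Icc a b →
      ∀ ξ ∈ closedBall (0 : Plane) R, ∀ ε ∈ Icc (0 : ℝ) 1, ∀ v ∈ g t ξ ε, ‖v‖ ≤ K := by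
  obtain ⟨μ, hμ, hgμ⟩ := hg (closedBall 0 R) isBounded_closedBall
  refine ⟨(eLpNormEssSup μ (volume.restrict (Icc a b))).toReal, ENNReal.toReal_nonneg, ?_⟩
  have h := ae_le_eLpNormEssSup (f := μ) (μ := volume.restrict (Icc a b))
  rw [ae_restrict_iff' measurableSet_Icc] at h
  filter_upwards [h] with t ht hmem ξ hξ ε hε v hv
  refine (hgμ t ξ hξ ε hε v hv).trans ((le_abs_self _).trans ?_)
  rw [← Real.norm_eq_abs, ← toReal_enorm]
  exact ENNReal.toReal_mono (by rw [← eLpNorm_exponent_top]; exact (hμ a b).eLpNorm_ne_top) (ht hmem)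

lemma IsUSC.upperHemicontinuous_comp (hg : IsUSC g) (hx₀ : Continuous x₀) :
    UpperHemicontinuous (fun τ => g τ (x₀ τ) 0) := by
  rw [← upperHemicontinuousOn_univ_iff]
  exact UpperHemicontinuousOn.comp (g := fun τ : ℝ => (τ, x₀ τ, (0 : ℝ))) hg
    (by fun_prop) (fun τ _ => ⟨mem_univ _, mem_univ _, by simp⟩)

lemma IsUSC.measurable_infDist (hg : IsUSC g) (hx₀ : Continuous x₀) {h : ℝ → Plane}
    (hh : Measurable h) : Measurable fun τ => infDist (h τ) (g τ (x₀ τ) 0) := by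
  have h1 : Measurable (fun p : ℝ × Plane => infEDist p.2 (g p.1 (x₀ p.1) 0 ∩ univ)) :=
    ((hg.upperHemicontinuous_comp hx₀).lowerSemicontinuous_infEDist isClosed_univ).measurable
  have h2 : Measurable (fun τ => (τ, h τ)) := measurable_id.prodMk hh
  have h3 := (h1.comp h2).ennreal_toReal
  simp only [inter_univ, Function.comp_def] at h3
  exact h3

/-- Upper semicontinuity at `(τ, x₀(τ), 0)` puts the values of `h ε` into any thickening of `g(τ,
x₀(τ), 0)`; the bound `2K` dominates. -/
lemma tendsto_integral_infDist (hgval : HasCompactConvexValues g) (hgusc : IsUSC g)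
    (hx₀ : Continuous x₀) {x h : ℝ → ℝ → Plane} {Δ : ℝ → ℝ}
    (hΔ : Tendsto Δ (𝓝[>] 0) (𝓝 0))
    (hx : ∀ τ, Tendsto (fun ε => x ε (τ + Δ ε)) (𝓝[>] 0) (𝓝 (x₀ τ)))
    (hm : ∀ᶠ ε in 𝓝[>] (0 : ℝ), Measurable (h ε))
    (hmem : ∀ᶠ ε in 𝓝[>] (0 : ℝ), ∀ᵐ τ, h ε τ ∈ g (τ + Δ ε) (x ε (τ + Δ ε)) ε)
    (hK : ∀ᶠ ε in 𝓝[>] (0 : ℝ), ∀ᵐ τ, τ ∈ Icc (-T) T → ‖h ε τ‖ ≤ K)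
    (hG : ∀ᵐ τ, τ ∈ Icc (-T) T → ∀ v ∈ g τ (x₀ τ) 0, ‖v‖ ≤ K) :
    Tendsto (fun ε => ∫ τ in Icc (-T) T, infDist (h ε τ) (g τ (x₀ τ) 0)) (𝓝[>] 0) (𝓝 0) := by
  classical
  -- The null set where membership fails depends on `ε`, and uncountably many are involved. The
  -- value `0` there makes the pointwise limit hold for every `τ`.
  let F : ℝ → ℝ → ℝ := fun ε τ =>
    if h ε τ ∈ g (τ + Δ ε) (x ε (τ + Δ ε)) ε then infDist (h ε τ) (g τ (x₀ τ) 0) else 0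
  have hFae : ∀ᶠ ε in 𝓝[>] (0 : ℝ), ∀ᵐ τ, infDist (h ε τ) (g τ (x₀ τ) 0) = F ε τ := by
    filter_upwards [hmem] with ε hε
    filter_upwards [hε] with τ hτ
    exact (if_pos hτ).symm
  have hne : ∀ τ, (g τ (x₀ τ) 0).Nonempty := fun τ => (hgval τ (x₀ τ) 0 (by simp)).1
  have hlim : Tendsto (fun ε => ∫ τ in Icc (-T) T, F ε τ) (𝓝[>] 0)
      (𝓝 (∫ _τ in Icc (-T) T, (0 : ℝ))) := by
    refine tendsto_integral_filter_of_dominated_convergence (fun _ => K + K) ?_ ?_ ?_ ?_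
    · filter_upwards [hm, hFae] with ε hε hF
      exact ((hgusc.measurable_infDist hx₀ hε).aestronglyMeasurable.congr hF).restrict
    · filter_upwards [hK, hFae] with ε hε hF
      rw [ae_restrict_iff' measurableSet_Icc]
      filter_upwards [hε, hF, hG] with τ h1 h2 h3 hτ
      obtain ⟨v, hv⟩ := hne τ
      rw [← h2, Real.norm_eq_abs, abs_of_nonneg infDist_nonneg]
      refine (infDist_le_dist_of_mem hv).trans ((dist_le_norm_add_norm _ _).trans ?_)
      exact add_le_add (h1 hτ) (h3 hτ v hv)
    · exact integrableOn_const (by simp)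
    · refine ae_of_all _ fun τ => ?_
      rw [Metric.tendsto_nhds]
      intro η hη
      have hev := hgusc.forall_isOpen (τ, x₀ τ, 0) ⟨mem_univ _, mem_univ _, by simp⟩ _
        (isOpen_thickening (δ := η) (E := g τ (x₀ τ) 0)) (self_subset_thickening hη _)
      have ht : Tendsto (fun ε => (τ + Δ ε, x ε (τ + Δ ε), ε)) (𝓝[>] (0 : ℝ))
          (𝓝[univ ×ˢ univ ×ˢ Icc (0 : ℝ) 1] (τ, x₀ τ, 0)) := by
        refine tendsto_nhdsWithin_iff.2 ⟨?_, ?_⟩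
        · have h1 : Tendsto (fun ε => τ + Δ ε) (𝓝[>] 0) (𝓝 τ) := by
            simpa using tendsto_const_nhds.add hΔ
          exact h1.prodMk_nhds ((hx τ).prodMk_nhds (tendsto_id.mono_left nhdsWithin_le_nhds))
        · filter_upwards [Ioc_mem_nhdsGT (show (0 : ℝ) < 1 by norm_num)] with ε hε
          exact ⟨mem_univ _, mem_univ _, hε.1.le, hε.2⟩
      filter_upwards [ht.eventually hev] with ε hε
      rw [Real.dist_eq, sub_zero]
      by_cases hc : h ε τ ∈ g (τ + Δ ε) (x ε (τ + Δ ε)) ε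
      · simp only [F, if_pos hc]
        rw [abs_of_nonneg infDist_nonneg]
        exact (mem_thickening_iff_infDist_lt (hne τ)).1 (hε hc)
      · simp only [F, if_neg hc]
        simpa using hη
  rw [integral_zero] at hlim
  refine hlim.congr' ?_
  filter_upwards [hFae] with ε hε
  exact integral_congr_ae (ae_restrict_of_ae (hε.mono fun _ h => h.symm))

lemma abs_integral_inner_sub_le {z h p : ℝ → Plane} {a b Cz : ℝ} (hz : Continuous z)
    (hCz : ∀ t ∈ Icc (-T) T, ‖z t‖ ≤ Cz) (ha : a ∈ Icc (-T) T) (hb : b ∈ Icc (-T) T) (hab : a ≤ b)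
    (hh : Measurable h) (hp : Measurable p)
    (hhK : ∀ᵐ t, t ∈ Icc (-T) T → ‖h t‖ ≤ K) (hpK : ∀ᵐ t, t ∈ Icc (-T) T → ‖p t‖ ≤ K) :
    |(∫ t in a..b, (inner ℝ (z t) (h t) : ℝ)) - ∫ t in a..b, (inner ℝ (z t) (p t) : ℝ)|
      ≤ Cz * ∫ t in Icc (-T) T, dist (h t) (p t) := by
  have hCz0 := (norm_nonneg _).trans (hCz a ha)
  have hdist : IntegrableOn (fun t => dist (h t) (p t)) (Icc (-T) T) volume := by
    refine Measure.integrableOn_of_bounded (M := K + K) (by simp)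
      (hh.dist hp).aestronglyMeasurable ?_
    rw [ae_restrict_iff' measurableSet_Icc]
    filter_upwards [hhK, hpK] with t h1 h2 ht
    rw [Real.norm_eq_abs, abs_of_nonneg dist_nonneg]
    exact (dist_le_norm_add_norm _ _).trans (add_le_add (h1 ht) (h2 ht))
  have hsub : Ioc a b ⊆ Icc (-T) T := fun t ht => ⟨ha.1.trans ht.1.le, ht.2.trans hb.2⟩
  rw [← intervalIntegral.integral_sub
    (intervalIntegrable_inner hz ha hb hh.aestronglyMeasurable hhK)
    (intervalIntegrable_inner hz ha hb hp.aestronglyMeasurable hpK), ← Real.norm_eq_abs]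
  calc ‖∫ t in a..b, ((inner ℝ (z t) (h t) : ℝ) - inner ℝ (z t) (p t))‖
      ≤ ∫ t in a..b, Cz * dist (h t) (p t) := by
        refine intervalIntegral.norm_integral_le_of_norm_le hab (ae_of_all _ fun t ht => ?_) ?_
        · rw [← inner_sub_right, dist_eq_norm]
          exact (norm_inner_le_norm _ _).trans (by gcongr; exact hCz t (hsub ht))
        · rw [intervalIntegrable_iff_integrableOn_Ioc_of_le hab]
          exact (hdist.mono_set hsub).const_mul Cz
    _ = Cz * ∫ t in Ioc a b, dist (h t) (p t) := by
        rw [intervalIntegral.integral_const_mul, intervalIntegral.integral_of_le hab]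
    _ ≤ Cz * ∫ t in Icc (-T) T, dist (h t) (p t) := by
        gcongr
        · exact ae_of_all _ fun _ => dist_nonneg

end Multivalued

end PlanarCycle

namespace PlanarCycle

/-! ### Equation for the deviation from the cycle -/

section Deviation

variable {f : Plane → Plane} {g : ℝ → Plane → ℝ → Set Plane} {T ε : ℝ} {x₀ x : ℝ → Plane}

/-- The measurable selection `(ẋ - f(x)) / ε` driving a solution of the perturbed inclusion, along
the time shift `c`. -/
noncomputable def forcing (f : Plane → Plane) (ε c : ℝ) (x : ℝ → Plane) (t : ℝ) : Plane :=
  ε⁻¹ • (deriv x (t + c) - f (x (t + c)))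

/-- The remainder of the linearization of `f` along `x₀`, evaluated at the shifted solution. -/
noncomputable def remainder (f : Plane → Plane) (c : ℝ) (x₀ x : ℝ → Plane) (t : ℝ) : Plane :=
  f (x (t + c)) - f (x₀ t) - fderiv ℝ f (x₀ t) (x (t + c) - x₀ t)

namespace IsPeriodicInclusionSolution

lemma continuous (hx : IsPeriodicInclusionSolution f g T ε x) : Continuous x :=
  AbsolutelyContinuousOnInterval.continuous_of_forall hx.absolutelyContinuous

lemma measurable_forcing (hx : IsPeriodicInclusionSolution f g T ε x) (hf : Continuous f) (c : ℝ) :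
    Measurable (forcing f ε c x) :=
  (((measurable_deriv x).comp (measurable_add_const c)).sub
    ((hf.comp (hx.continuous.comp (continuous_add_const c))).measurable)).const_smul ε⁻¹

/-- The inclusion supplies a vector at each time with no measurability; uniqueness of derivatives
identifies it with the measurable `forcing`. -/
lemma ae_forcing (hx : IsPeriodicInclusionSolution f g T ε x) (hε : ε ≠ 0) (c : ℝ) :
    ∀ᵐ t, forcing f ε c x t ∈ g (t + c) (x (t + c)) ε ∧
      HasDerivAt x (f (x (t + c)) + ε • forcing f ε c x t) (t + c) := by
  filter_upwards [ae_comp_add_right hx.inclusion c] with t ht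
  obtain ⟨v, hv, hd⟩ := ht
  have e : forcing f ε c x t = v := by
    rw [forcing, hd.deriv, add_sub_cancel_left, inv_smul_smul₀ hε]
  rw [e]
  exact ⟨hv, hd⟩

lemma inner_sub_inner_eq_integral (hx : IsPeriodicInclusionSolution f g T ε x) (hε : ε ≠ 0)
    (hf : ContDiff ℝ 1 f) (hx₀ : ∀ t, HasDerivAt x₀ (f (x₀ t)) t) {z : ℝ → Plane}
    (hz : IsAdjointSolution f x₀ z) (c a b : ℝ) :
    (inner ℝ (z b) (x (b + c) - x₀ b) : ℝ) - inner ℝ (z a) (x (a + c) - x₀ a)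
      = ∫ t in a..b, (inner ℝ (z t) (remainder f c x₀ x t + ε • forcing f ε c x t) : ℝ) := by
  have hx₀c : Continuous x₀ := continuous_iff_continuousAt.2 fun t => (hx₀ t).continuousAt
  have hA : Continuous fun t => fderiv ℝ f (x₀ t) :=
    (hf.continuous_fderiv (by norm_num)).comp hx₀c
  have hA' : Continuous fun t => ContinuousLinearMap.adjoint (fderiv ℝ f (x₀ t)) :=
    ContinuousLinearMap.adjoint.continuous.comp hA
  refine PlanarCycle.inner_sub_inner_eq_integral (A := fun t => fderiv ℝ f (x₀ t))
    (w := fun t => x (t + c) - x₀ t) hz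
    (.of_hasDerivAt hz (hA'.clm_apply hz.continuous).neg a b)
    ((hx.absolutelyContinuous _ _).comp_add_const.sub
      (.of_hasDerivAt hx₀ (hf.continuous.comp hx₀c) a b)) ?_
  filter_upwards [hx.ae_forcing hε c] with t ht
  refine ((ht.2.comp_add_const t c).sub (hx₀ t)).congr_deriv ?_
  simp only [remainder]
  abel

end IsPeriodicInclusionSolution

lemma continuous_remainder (hf : ContDiff ℝ 1 f) (hx₀ : Continuous x₀) (hx : Continuous x) (c : ℝ) :
    Continuous (remainder f c x₀ x) := by
  have hA : Continuous fun t => fderiv ℝ f (x₀ t) :=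
    (hf.continuous_fderiv (by norm_num)).comp hx₀
  have hxc : Continuous fun t => x (t + c) := hx.comp (continuous_add_const c)
  exact ((hf.continuous.comp hxc).sub (hf.continuous.comp hx₀)).sub (hA.clm_apply (hxc.sub hx₀))

end Deviation

/-! ### Approximation by elements of `Mperp` -/

section Selections

open Metric

variable {g : ℝ → Plane → ℝ → Set Plane} {T κ K : ℝ} {x₀ zh zt h : ℝ → Plane} {ts : ℝ}

/-- Integrals of a bounded function against `zh` are close to `M^⊥`, up to the mean distance of the
function to the values of `g` along the cycle. -/
lemma FloquetData.exists_mem_Mperp (fl : FloquetData T x₀ zh zt κ) (hts : zt ts 0 = 0)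
    (hgval : HasCompactConvexValues g) (hgusc : IsUSC g) (hx₀ : Continuous x₀) (hzh : Continuous zh)
    {Cz : ℝ} (hCz : ∀ t ∈ Icc (-T) T, ‖zh t‖ ≤ Cz)
    (hG : ∀ᵐ τ, τ ∈ Icc (-T) T → ∀ v ∈ g τ (x₀ τ) 0, ‖v‖ ≤ K)
    (hh : Measurable h) (hhK : ∀ᵐ τ, τ ∈ Icc (-T) T → ‖h τ‖ ≤ K) {t : ℝ} (ht : t ∈ Icc 0 T) :
    ∃ m ∈ Mperp g T x₀ zh zt ts t,
      |κ⁻¹ * (∫ τ in (t - T)..t, (inner ℝ (zh τ) (h τ) : ℝ)) - m|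
        ≤ |κ|⁻¹ * (Cz * ∫ τ in Icc (-T) T, infDist (h τ) (g τ (x₀ τ) 0)) := by
  obtain ⟨p, hpm, hpG, hpd⟩ := (hgusc.upperHemicontinuous_comp hx₀).exists_measurable_infDist_eq
    (fun τ => (hgval τ (x₀ τ) 0 (by simp)).1) (fun τ => (hgval τ (x₀ τ) 0 (by simp)).2.1)
    (fun τ => (hgval τ (x₀ τ) 0 (by simp)).2.2) hh
  have hpK : ∀ᵐ τ, τ ∈ Icc (-T) T → ‖p τ‖ ≤ K := hG.mono fun τ hτ hmem => hτ hmem _ (hpG τ)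
  refine ⟨κ⁻¹ * ∫ τ in (t - T)..t, (inner ℝ (zh τ) (p τ) : ℝ), ⟨p, ?_, ae_of_all _ hpG, ?_⟩, ?_⟩
  · exact memLp_top_of_bound hpm.aestronglyMeasurable K
      ((ae_restrict_iff' measurableSet_Icc).2 hpK)
  · rw [fl.gam_eq hts]
  · simp only [hpd]
    rw [← mul_sub, abs_mul, abs_inv]
    gcongr
    have hT : 0 ≤ T := ht.1.trans ht.2
    exact abs_integral_inner_sub_le hzh hCz ⟨by linarith [ht.1], by linarith [ht.2]⟩
      ⟨by linarith [ht.1], ht.2⟩ (by linarith) hh hpm hhK hpK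

/-- The distance of a vector to the affine pieces over a set of coefficients. -/
lemma FloquetData.infDist_image_le (fl : FloquetData T x₀ zh zt κ) {M : Set ℝ} {m : ℝ} (hm : m ∈ M)
    (ε t : ℝ) (v : Plane) :
    infDist v ((fun m : ℝ => (ε * m) • yFun zh zt t + (inner ℝ (zh t) v : ℝ) • deriv x₀ t) '' M)
      ≤ |(inner ℝ (zt t) v : ℝ) - ε * m| * ‖yFun zh zt t‖ := by
  refine (infDist_le_dist_of_mem (mem_image_of_mem _ hm)).trans (le_of_eq ?_)
  rw [dist_eq_norm, ← Real.norm_eq_abs, ← norm_smul]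
  congr 1
  -- The `ẋ₀` components agree exactly, so only the `y` components are compared.
  rw [sub_smul, ← sub_eq_of_eq_add' (fl.decomp t v)]
  abel

end Selections

end PlanarCycle

/-! ### Assembly of the asymptotic formula -/

namespace PlanarCycle

variable {f : Plane → Plane} {g : ℝ → Plane → ℝ → Set Plane} {T κ : ℝ} {x₀ zh zt : ℝ → Plane}
  {x : ℝ → ℝ → Plane} {Δ : ℝ → ℝ} {ts : ℝ}

lemma IsCycle.continuous (hx₀ : IsCycle f T x₀) : Continuous x₀ :=
  continuous_iff_continuousAt.2 fun t => (hx₀.isSolution t).continuousAt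

lemma IsCycle.exists_norm_le (hx₀ : IsCycle f T x₀) : ∃ R, ∀ t, ‖x₀ t‖ ≤ R := by
  obtain ⟨R, hR⟩ := isCompact_Icc.exists_bound_of_continuousOn (s := Icc 0 T)
    hx₀.continuous.continuousOn
  refine ⟨R, fun t => ?_⟩
  obtain ⟨s, hs, hts⟩ := hx₀.periodic.exists_mem_Ico₀ hx₀.period_pos t
  rw [hts]
  exact hR s (Ico_subset_Icc_self hs)

lemma IsCycle.isCompact_range (hx₀ : IsCycle f T x₀) : IsCompact (range x₀) := by
  have : range x₀ = x₀ '' Icc 0 T := by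
    have h := hx₀.periodic.image_Icc hx₀.period_pos 0
    rw [zero_add] at h
    exact h.symm
  rw [this]
  exact isCompact_Icc.image hx₀.continuous

lemma IsCycle.uniformContinuous (hx₀ : IsCycle f T x₀) (hf : Continuous f) :
    UniformContinuous x₀ := by
  obtain ⟨C, hC⟩ := hx₀.isCompact_range.exists_bound_of_continuousOn hf.continuousOn
  have hC' : ∀ t, ‖deriv x₀ t‖₊ ≤ C.toNNReal := fun t => by
    rw [(hx₀.isSolution t).deriv, ← norm_toNNReal]
    exact Real.toNNReal_le_toNNReal (hC _ (mem_range_self t))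
  exact (lipschitzWith_of_nnnorm_deriv_le
    (fun t => (hx₀.isSolution t).differentiableAt) hC').uniformContinuous

/-- Shifted solutions stay uniformly close to the cycle when the shift tends to `0`. -/
lemma IsCycle.eventually_shift_norm_lt (hf : Continuous f) (hx₀ : IsCycle f T x₀)
    (hΔ : Tendsto Δ (𝓝[>] 0) (𝓝 0))
    (hunif : ∀ δ > 0, ∀ᶠ ε in 𝓝[>] (0 : ℝ), ∀ t, ‖x ε t - x₀ t‖ < δ) {δ : ℝ} (hδ : 0 < δ) :
    ∀ᶠ ε in 𝓝[>] (0 : ℝ), ∀ t, ‖x ε (t + Δ ε) - x₀ t‖ < δ := by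
  obtain ⟨s, hs, hsδ⟩ := Metric.uniformContinuous_iff.1 (hx₀.uniformContinuous hf) (δ / 2)
    (by positivity)
  filter_upwards [hunif (δ / 2) (by positivity), Metric.tendsto_nhds.1 hΔ s hs] with ε h1 h2 t
  have h3 : ‖x₀ (t + Δ ε) - x₀ t‖ < δ / 2 := by
    rw [← dist_eq_norm]
    exact hsδ (by simpa [Real.dist_eq] using h2)
  calc ‖x ε (t + Δ ε) - x₀ t‖
      = ‖(x ε (t + Δ ε) - x₀ (t + Δ ε)) + (x₀ (t + Δ ε) - x₀ t)‖ := by congr 1; abel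
    _ < δ := (norm_add_le _ _).trans_lt (by linarith [h1 (t + Δ ε)])

lemma exists_shift (hx₀ : IsCycle f T x₀)
    (hx : ∀ᶠ ε in 𝓝[>] (0 : ℝ), IsPeriodicInclusionSolution f g T ε (x ε))
    (hunif : ∀ δ > 0, ∀ᶠ ε in 𝓝[>] (0 : ℝ), ∀ t, ‖x ε t - x₀ t‖ < δ)
    {p : Plane} (hp : inner ℝ p (deriv x₀ 0) = (1 : ℝ)) :
    ∃ Δ : ℝ → ℝ, Tendsto Δ (𝓝[>] 0) (𝓝 0) ∧
      ∀ᶠ ε in 𝓝[>] (0 : ℝ), (inner ℝ p (x ε (0 + Δ ε) - x₀ 0) : ℝ) = 0 := by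
  have h := exists_tendsto_zero_of_hasDerivAt (l := 𝓝[>] (0 : ℝ))
    (φ := fun ε t => (inner ℝ p (x ε t - x₀ 0) : ℝ)) (φ₀ := fun t => (inner ℝ p (x₀ t - x₀ 0) : ℝ))
    (by simp) ?_ ?_ ?_
  · simpa only [zero_add] using h
  · have h1 := (hasDerivAt_const (0 : ℝ) p).inner ℝ
      ((hx₀.isSolution 0).differentiableAt.hasDerivAt.sub_const (x₀ 0))
    simpa [hp] using h1
  · filter_upwards [hx] with ε hε
    exact continuous_const.inner (hε.continuous.sub continuous_const)
  · intro δ hδ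
    filter_upwards [hunif (δ / (‖p‖ + 1)) (by positivity)] with ε hε t
    rw [← inner_sub_right, sub_sub_sub_cancel_right, ← Real.norm_eq_abs]
    calc _ ≤ ‖p‖ * ‖x ε t - x₀ t‖ := norm_inner_le_norm _ _
      _ ≤ (‖p‖ + 1) * ‖x ε t - x₀ t‖ := by gcongr; linarith
      _ < (‖p‖ + 1) * (δ / (‖p‖ + 1)) := by gcongr; exact hε t
      _ = δ := by field_simp

/-- The asymptotic description of the perturbed solutions, for any shift that tends to `0` and
places them on the line through `x₀ 0` orthogonal to `zh 0`. -/
lemma FloquetData.tendstoUniformlyOn_infDist (fl : FloquetData T x₀ zh zt κ) (hf : ContDiff ℝ 1 f)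
    (hgval : HasCompactConvexValues g) (hgusc : IsUSC g) (hgH : ConditionH g)
    (hx₀ : IsCycle f T x₀)
    (hx : ∀ᶠ ε in 𝓝[>] (0 : ℝ), IsPeriodicInclusionSolution f g T ε (x ε))
    (hunif : ∀ δ > 0, ∀ᶠ ε in 𝓝[>] (0 : ℝ), ∀ t, ‖x ε t - x₀ t‖ < δ)
    (hztT : Function.Periodic zt T) (hzh : IsAdjointSolution f x₀ zh)
    (hy : Continuous (yFun zh zt)) (hzts : zt ts 0 = 0)
    (hΔ : Tendsto Δ (𝓝[>] 0) (𝓝 0))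
    (hΔ0 : ∀ᶠ ε in 𝓝[>] (0 : ℝ), (inner ℝ (zh 0) (x ε (0 + Δ ε) - x₀ 0) : ℝ) = 0) :
    TendstoUniformlyOn
      (fun ε t => Metric.infDist (x ε (t + Δ ε) - x₀ t)
        ((fun m : ℝ => (ε * m) • yFun zh zt t
            + (inner ℝ (zh t) (x ε (t + Δ ε) - x₀ t) : ℝ) • deriv x₀ t) ''
          Mperp g T x₀ zh zt ts t) / ε)
      (fun _ => 0) (𝓝[>] (0 : ℝ)) (Icc 0 T) := by
  have hT := hx₀.period_pos
  have hshift := fun δ (hδ : 0 < δ) => hx₀.eventually_shift_norm_lt hf.continuous hΔ hunif hδ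
  have hIoc : ∀ᶠ ε in 𝓝[>] (0 : ℝ), ε ∈ Ioc (0 : ℝ) 1 := Ioc_mem_nhdsGT (by norm_num)
  obtain ⟨R, hR⟩ := hx₀.exists_norm_le
  -- The margins of `1` absorb a time shift and a deviation from the cycle, both eventually below
  -- `1`.
  obtain ⟨K, hK0, hK⟩ := hgH.exists_ae_bound (-T - 1) (T + 1) (R + 1)
  have hG : ∀ᵐ τ, τ ∈ Icc (-T) T → ∀ v ∈ g τ (x₀ τ) 0, ‖v‖ ≤ K := by
    filter_upwards [hK] with τ hτ hmem
    exact hτ ⟨by linarith [hmem.1], by linarith [hmem.2]⟩ (x₀ τ)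
      (by rw [mem_closedBall_zero_iff]; linarith [hR τ]) 0 (by simp)
  have hmem : ∀ᶠ ε in 𝓝[>] (0 : ℝ), ∀ᵐ τ,
      forcing f ε (Δ ε) (x ε) τ ∈ g (τ + Δ ε) (x ε (τ + Δ ε)) ε := by
    filter_upwards [hx, hIoc] with ε hε h01
    exact (hε.ae_forcing h01.1.ne' (Δ ε)).mono fun _ h => h.1
  have hm : ∀ᶠ ε in 𝓝[>] (0 : ℝ), Measurable (forcing f ε (Δ ε) (x ε)) :=
    hx.mono fun ε hε => hε.measurable_forcing hf.continuous _
  have hbound : ∀ᶠ ε in 𝓝[>] (0 : ℝ), ∀ᵐ τ, τ ∈ Icc (-T) T →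
      ‖forcing f ε (Δ ε) (x ε) τ‖ ≤ K := by
    filter_upwards [hmem, hIoc, hshift 1 one_pos, Metric.tendsto_nhds.1 hΔ 1 one_pos]
      with ε hε h01 h1 hΔ1
    filter_upwards [hε, ae_comp_add_right hK (Δ ε)] with τ h2 h3 hτ
    rw [Real.dist_eq, sub_zero, abs_lt] at hΔ1
    refine h3 ⟨by linarith [hτ.1], by linarith [hτ.2]⟩ _ ?_ ε ⟨h01.1.le, h01.2⟩ _ h2
    rw [mem_closedBall_zero_iff]
    linarith [norm_sub_norm_le (x ε (τ + Δ ε)) (x₀ τ), h1 τ, hR τ]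
  have hlim := tendsto_integral_infDist (T := T) (K := K) hgval hgusc hx₀.continuous hΔ
    (fun τ => by
      rw [Metric.tendsto_nhds]
      intro δ hδ
      filter_upwards [hshift δ hδ] with ε hε
      rw [dist_eq_norm]
      exact hε τ) hm hmem hbound hG
  obtain ⟨η₀, hη₀, C, hC, hest⟩ := fl.exists_estimate hT hzh.continuous hztT
    (hx₀.isLinearizedSolution_deriv hf).continuous hy hK0
  obtain ⟨Cz, hCz⟩ := isCompact_Icc.exists_bound_of_continuousOn (s := Icc (-T) T)
    hzh.continuous.continuousOn
  obtain ⟨Cy, hCy⟩ := isCompact_Icc.exists_bound_of_continuousOn (s := Icc 0 T) hy.continuousOn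
  have hCy0 : 0 ≤ Cy := (norm_nonneg _).trans (hCy 0 ⟨le_rfl, hT.le⟩)
  rw [Metric.tendstoUniformlyOn_iff]
  intro e he
  -- Half of `e` is spent on the linearization error and half on the distance to the selections; the
  -- `+ 1` keeps the denominator positive.
  set η := min η₀ (e / (2 * (Cy * C + 1))) with hη
  have hηpos : 0 < η := lt_min hη₀ (by positivity)
  have hηe : Cy * (C * η) < e / 2 := by
    calc Cy * (C * η) = (Cy * C) * η := by ring
      _ < (Cy * C + 1) * η := by gcongr; linarith
      _ ≤ (Cy * C + 1) * (e / (2 * (Cy * C + 1))) := by gcongr; exact min_le_right _ _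
      _ = e / 2 := by field_simp
  obtain ⟨δ, hδ, hlinz⟩ := exists_linearization_bound hf hx₀.isCompact_range hηpos
  have hsmall : ∀ᶠ ε in 𝓝[>] (0 : ℝ), Cy * (|κ|⁻¹ * (Cz * ∫ τ in Icc (-T) T,
      Metric.infDist (forcing f ε (Δ ε) (x ε) τ) (g τ (x₀ τ) 0))) < e / 2 := by
    have h := ((hlim.const_mul Cz).const_mul |κ|⁻¹).const_mul Cy
    rw [mul_zero, mul_zero, mul_zero] at h
    exact h.eventually_lt_const (by positivity)
  filter_upwards [hx, hIoc, hm, hbound, hΔ0, hshift δ hδ, hsmall] with ε hε h01 hmε hbε h0 hδε hs t ht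
  have hper : Function.Periodic (fun t => x ε (t + Δ ε) - x₀ t) T := fun s => by
    simp only [add_right_comm s T, hε.periodic (s + Δ ε), hx₀.periodic s]
  have hestε := hest ε h01.1 η hηpos.le (min_le_left _ _) (fun t => x ε (t + Δ ε) - x₀ t)
    (remainder f (Δ ε) x₀ (x ε)) (forcing f ε (Δ ε) (x ε))
    ((hε.continuous.comp (continuous_add_const _)).sub hx₀.continuous) hper
    (continuous_remainder hf hx₀.continuous hε.continuous _)
    (fun s => by
      have := hlinz (x₀ s) (mem_range_self s) _ (hδε s)
      rwa [add_sub_cancel] at this)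
    hmε.aestronglyMeasurable hbε
    (fun a b => hε.inner_sub_inner_eq_integral h01.1.ne' hf hx₀.isSolution hzh (Δ ε) a b) h0 t ht
  obtain ⟨m, hmM, hmle⟩ := fl.exists_mem_Mperp hzts hgval hgusc hx₀.continuous hzh.continuous hCz hG
    hmε hbε ht
  have hdist := fl.infDist_image_le hmM ε t (x ε (t + Δ ε) - x₀ t)
  rw [Real.dist_eq, zero_sub, abs_neg, abs_of_nonneg (div_nonneg Metric.infDist_nonneg h01.1.le),
    div_lt_iff₀ h01.1]
  set I := ∫ τ in Icc (-T) T, Metric.infDist (forcing f ε (Δ ε) (x ε) τ) (g τ (x₀ τ) 0)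
  set J := ∫ τ in (t - T)..t, (inner ℝ (zh τ) (forcing f ε (Δ ε) (x ε) τ) : ℝ)
  have htri : |(inner ℝ (zt t) (x ε (t + Δ ε) - x₀ t) : ℝ) - ε * m|
      ≤ C * η * ε + ε * (|κ|⁻¹ * (Cz * I)) := by
    calc _ = |((inner ℝ (zt t) (x ε (t + Δ ε) - x₀ t) : ℝ) - ε * (κ⁻¹ * J))
            + ε * (κ⁻¹ * J - m)| := by congr 1; ring
      _ ≤ _ := by
          refine (abs_add_le _ _).trans (add_le_add hestε ?_)
          rw [abs_mul, abs_of_pos h01.1]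
          exact mul_le_mul_of_nonneg_left hmle h01.1.le
  calc _ ≤ _ := hdist
    _ ≤ (C * η * ε + ε * (|κ|⁻¹ * (Cz * I))) * Cy := by
        gcongr
        · exact (abs_nonneg _).trans htri
        · exact hCy t ht
    _ = (Cy * (C * η) + Cy * (|κ|⁻¹ * (Cz * I))) * ε := by ring
    _ < e * ε := by
        gcongr
        · exact h01.1
        · linarith

/-- Projecting the zero function yields a bounded measurable selection. -/
lemma FloquetData.nonempty_Mperp (fl : FloquetData T x₀ zh zt κ) (hts : zt ts 0 = 0)
    (hgval : HasCompactConvexValues g) (hgusc : IsUSC g) (hgH : ConditionH g)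
    (hx₀ : IsCycle f T x₀) (hzh : Continuous zh) {t : ℝ} (ht : t ∈ Icc 0 T) :
    (Mperp g T x₀ zh zt ts t).Nonempty := by
  obtain ⟨R, hR⟩ := hx₀.exists_norm_le
  obtain ⟨K, hK0, hK⟩ := hgH.exists_ae_bound (-T) T R
  obtain ⟨Cz, hCz⟩ := isCompact_Icc.exists_bound_of_continuousOn (s := Icc (-T) T) hzh.continuousOn
  obtain ⟨m, hm, -⟩ := fl.exists_mem_Mperp (K := K) (h := fun _ => 0) hts hgval hgusc hx₀.continuous
    hzh hCz
    (hK.mono fun τ hτ hmem => hτ hmem _ (mem_closedBall_zero_iff.2 (hR τ)) 0 (by simp))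
    measurable_const (ae_of_all _ fun _ _ => by simpa using hK0) ht
  exact ⟨m, hm⟩

end PlanarCycle

theorem theorem3 (f : PlanarCycle.Plane → PlanarCycle.Plane)
    (g : ℝ → PlanarCycle.Plane → ℝ → Set PlanarCycle.Plane)
    (T : ℝ) (x₀ : ℝ → PlanarCycle.Plane) (x : ℝ → ℝ → PlanarCycle.Plane)
    (zt zh : ℝ → PlanarCycle.Plane) (ts : ℝ)
    (hf : ContDiff ℝ 1 f) (hHam : PlanarCycle.IsHamiltonianField f)
    (hgval : PlanarCycle.HasCompactConvexValues g)
    (hgusc : PlanarCycle.IsUSC g) (hgH : PlanarCycle.ConditionH g)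
    (hx₀ : PlanarCycle.IsCycle f T x₀) (hnd : PlanarCycle.IsNondegenerate f T x₀)
    (hx : ∀ᶠ ε in 𝓝[>] (0 : ℝ), PlanarCycle.IsPeriodicInclusionSolution f g T ε (x ε))
    (hconv : TendstoUniformlyOn x x₀ (𝓝[>] (0 : ℝ)) (Icc 0 T))
    (hzt : PlanarCycle.IsAdjointSolution f x₀ zt) (hztT : Function.Periodic zt T)
    (hzh : PlanarCycle.IsAdjointSolution f x₀ zh)
    (hlin : LinearIndependent ℝ ![zh, zt])
    (hnorm : inner ℝ (deriv x₀ 0) (zh 0) = 1)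
    (hts : ts ∈ Icc 0 T) (hzts : zt ts 0 = 0) :
    (PlanarCycle.IsLinearizedSolution f x₀ (PlanarCycle.yFun zh zt) ∧
      ¬ Function.Periodic (PlanarCycle.yFun zh zt) T) ∧
    (∀ t ∈ Icc 0 T, (PlanarCycle.Mperp g T x₀ zh zt ts t).Nonempty) ∧
    ∃ Δ : ℝ → ℝ, Tendsto Δ (𝓝[>] 0) (𝓝 0) ∧
      TendstoUniformlyOn
        (fun ε t => Metric.infDist (x ε (t + Δ ε) - x₀ t)
          ((fun m : ℝ => (ε * m) • PlanarCycle.yFun zh zt t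
              + inner ℝ (zh t) (x ε (t + Δ ε) - x₀ t) • deriv x₀ t) ''
            PlanarCycle.Mperp g T x₀ zh zt ts t) / ε)
        (fun _ => 0) (𝓝[>] (0 : ℝ)) (Icc 0 T) := by
  have htr := fun ξ => hHam.traceZero ξ
  obtain ⟨κ, fl⟩ := PlanarCycle.exists_floquetData hf htr hx₀ hnd hzt hztT hzh hlin hnorm
  have hy := PlanarCycle.isLinearizedSolution_yFun htr hzt hzh
  have hunif := fun δ (hδ : (0 : ℝ) < δ) => PlanarCycle.eventually_forall_norm_sub_lt
    hx₀.period_pos hx₀.periodic (hx.mono fun _ h => h.periodic) hconv hδ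
  obtain ⟨Δ, hΔ, hΔ0⟩ := PlanarCycle.exists_shift hx₀ hx hunif (fl.inner_zh_deriv 0)
  exact ⟨⟨hy, fl.not_periodic_yFun htr hzt hzh⟩,
    fun t ht => fl.nonempty_Mperp hzts hgval hgusc hgH hx₀ hzh.continuous ht,
    Δ, hΔ, fl.tendstoUniformlyOn_infDist hf hgval hgusc hgH hx₀ hx hunif hztT hzh hy.continuous
      hzts hΔ hΔ0⟩
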